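/- Let $q\in\mathbb N$, $\epsilon=(-1)^q$, and let $\Lambda$ be a weakly finite ring with $1$ and involution $a\mapsto\bar a$ (weakly finite: $\Lambda^n\cong\Lambda^n\oplus K$ implies $K=0$). Modules are left modules; $M^*=\operatorname{Hom}_\Lambda(M,\Lambda)$ with $(af)(x)=f(x)\bar a$, f.g. free modules are identified with their double duals, $Q_{\pm\epsilon}(M)=\operatorname{coker}(\varphi\mapsto\varphi\mp\epsilon\varphi^*)$ on $\operatorname{Hom}_\Lambda(M,M^*)$, $H_{\pm\epsilon}(P)=\bigl(P\oplus P^*,\begin{pmatrix}0&1\\0&0\end{pmatrix}\bigr)$ is the hyperbolic $\pm\epsilon$-quadratic form, and $L_{2q+2}(\Lambda)$ is the Witt group of non-singular $(-\epsilon)$-quadratic forms on f.g. free modules modulo hyperbolic forms on f.g. free modules. A (regular) $\epsilon$-quadratic split preformation $z=(F\xleftarrow{\gamma}G\xrightarrow{\mu}F^*,\bar\theta)$ consists of f.g. free modules $F,G$, homomorphisms $\gamma,\mu$ and $\bar\theta\in Q_{-\epsilon}(G)$ with $\theta-\epsilon\theta^*=\gamma^*\mu$ for representatives $\theta$ of $\bar\theta$.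 It is a non-singular formation if $\binom{\gamma}{\mu}\colon G\to H_\epsilon(F)$ is the inclusion of a lagrangian. A strong isomorphism $z\to z'$ is a pair of isomorphisms $\alpha\colon F\to F'$, $\beta\colon G\to G'$ with $\alpha\gamma=\gamma'\beta$, $\alpha^{-*}\mu=\mu'\beta$ and $\bar\theta=\beta^*\bar\theta'\beta$. With $\partial H_{-\epsilon}(P)=(K\xleftarrow{1}K\xrightarrow{\kappa-\epsilon\kappa^*}K^*,\bar\kappa)$ for $(K,\bar\kappa)=H_{-\epsilon}(P)$, $P$ f.g. free, $z$ and $z'$ are stably strongly isomorphic, $[z]=[z']\in l_{2q+2}(\Lambda)$, if $z\oplus\partial H_{-\epsilon}(P)$ and $z'\oplus\partial H_{-\epsilon}(P')$ are strongly isomorphic for some f.g. free $P,P'$. The preformation $z$ is elementary if there is a f.g. free submodule $j\colon U\hookrightarrow G$ with $j^*\gamma^*\mu j=0$ and $j^*\bar\theta j=0\in Q_{-\epsilon}(U)$, such that $\gamma j$ and $\mu j$ are injective with images direct summands of $F$ and $F^*$, and restriction induces an isomorphism $F^*/\mu(U)\to\gamma(U)^*$. The class $[z']$ is elementary if it has an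 elementary representative. A flip-isomorphism $t=(\alpha,\beta,\bar\nu)$ of $z$ consists of isomorphisms $\alpha\colon F\to F^*$, $\beta\colon G\to G$ and $\bar\nu\in Q_{-\epsilon}(F^*)$ with $$\alpha\gamma+\alpha(\bar\nu-\epsilon\bar\nu^*)^*\mu=\epsilon\mu\beta,\qquad \alpha^{-*}\mu=\gamma\beta,\qquad \bar\theta+\mu^*\bar\nu\mu+\beta^*\bar\theta\beta=0\in Q_{-\epsilon}(G).$$ An extension $(\tilde\gamma,\tilde\mu,\tilde\theta)$ of $(\gamma,\mu)$ to an isometry $H_\epsilon(G)\cong H_\epsilon(F)$ consists of homomorphisms $\tilde\gamma\colon G^*\to F$, $\tilde\mu\colon G^*\to F^*$, $\tilde\theta\colon G^*\to G$ such that, for a representative $\theta$ of $\bar\theta$, $$f=\begin{pmatrix}\gamma&\tilde\gamma\\\mu&\tilde\mu\end{pmatrix}\colon G\oplus G^*\to F\oplus F^*$$ is an isomorphism with $$f^*\begin{pmatrix}0&1\\0&0\end{pmatrix}f-\begin{pmatrix}0&1\\0&0\end{pmatrix}=X-\epsilon X^*,\qquad X=\begin{pmatrix}\theta&0\\\tilde\gamma^*\mu&\tilde\theta\end{pmatrix}.$$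 The quadratic signature $\tilde\rho^*(z,t,\tilde\gamma,\tilde\mu,\tilde\theta)\in L_{2q+2}(\Lambda)$ is the class of the non-singular $(-\epsilon)$-quadratic form $(M,\xi')$, where $\nu$ is a representative of $\bar\nu$ and $$\xi'=\begin{pmatrix}\tilde\gamma^*\tilde\mu+\tilde\gamma^*\alpha\nu\alpha^*\tilde\gamma&-\tilde\gamma^*\alpha\gamma&0\\0&\epsilon\theta^*&0\\\epsilon(\alpha^*\tilde\gamma-\tilde\mu)&-\mu&0\end{pmatrix}\colon M=G^*\oplus G\oplus F\to M^*.$$ Theorem. Let $z'$ be a non-singular $\epsilon$-quadratic split formation. Then $[z']\in l_{2q+2}(\Lambda)$ is elementary if and only if there are a preformation $z=(F\xleftarrow{\gamma}G\xrightarrow{\mu}F^*,\bar\theta)$ stably strongly isomorphic to $z'$, a flip-isomorphism $t$ of $z$ and an extension $(\tilde\gamma,\tilde\mu,\tilde\theta)$ of $(\gamma,\mu)$ to an isometry $H_\epsilon(G)\cong H_\epsilon(F)$ such that $\tilde\rho^*(z,t,\tilde\gamma,\tilde\mu,\tilde\theta)=0\in L_{2q+2}(\Lambda)$. -/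

import Mathlib

universe u

namespace SurgeryL

section Duality

/-- The dual `M* = Hom_Λ(M, Λ)` of a left `Λ`-module `M` over a ring with involution, as a left
`Λ`-module: `(a f)(x) = f(x) ā`. -/
def InvDual (Λ : Type*) [Ring Λ] [StarRing Λ] (M : Type*) [AddCommGroup M] [Module Λ M] :=
  M →ₗ[Λ] Λ

variable {Λ : Type*} [Ring Λ] [StarRing Λ]
variable {M N K : Type*} [AddCommGroup M] [Module Λ M] [AddCommGroup N] [Module Λ N]
  [AddCommGroup K] [Module Λ K]

instance : AddCommGroup (InvDual Λ M) := inferInstanceAs (AddCommGroup (M →ₗ[Λ] Λ))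

instance : FunLike (InvDual Λ M) M Λ := inferInstanceAs (FunLike (M →ₗ[Λ] Λ) M Λ)

instance : LinearMapClass (InvDual Λ M) Λ M Λ :=
  inferInstanceAs (LinearMapClass (M →ₗ[Λ] Λ) Λ M Λ)

namespace InvDual

@[ext] theorem ext {f g : InvDual Λ M} (h : ∀ x, f x = g x) : f = g := DFunLike.ext f g h

/-- A functional, given as a linear map. -/
def of (f : M →ₗ[Λ] Λ) : InvDual Λ M := f

@[simp] theorem of_apply (f : M →ₗ[Λ] Λ) (x : M) : of f x = f x := rfl

@[simp] theorem add_apply (f g : InvDual Λ M) (x : M) : (f + g) x = f x + g x := rfl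

@[simp] theorem zero_apply (x : M) : (0 : InvDual Λ M) x = 0 := rfl

@[simp] theorem neg_apply (f : InvDual Λ M) (x : M) : (-f) x = -f x := rfl

@[simp] theorem sub_apply (f g : InvDual Λ M) (x : M) : (f - g) x = f x - g x := rfl

instance : SMul Λ (InvDual Λ M) where
  smul a f := of
    { toFun := fun x => f x * star a
      map_add' := fun x y => by rw [map_add, add_mul]
      map_smul' := fun b x => by simp [mul_assoc] }

@[simp] theorem smul_apply (a : Λ) (f : InvDual Λ M) (x : M) : (a • f) x = f x * star a := rfl

instance : Module Λ (InvDual Λ M) where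
  one_smul f := by ext x; simp
  mul_smul a b f := by ext x; simp [mul_assoc]
  smul_zero a := by ext x; simp
  smul_add a f g := by ext x; simp [add_mul]
  add_smul a b f := by ext x; simp [mul_add]
  zero_smul f := by ext x; simp

@[simp] theorem zsmul_apply (n : ℤ) (f : InvDual Λ M) (x : M) : (n • f) x = n • f x :=
  LinearMap.smul_apply (σ₁₂ := RingHom.id Λ) (M := M) (M₂ := Λ) n f x

@[simp] theorem units_smul_apply (e : ℤˣ) (f : InvDual Λ M) (x : M) : (e • f) x = e • f x :=
  zsmul_apply _ f x

end InvDual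

/-- The dual `f* : N* → M*` of `f : M → N`. -/
def dualMap (f : M →ₗ[Λ] N) : InvDual Λ N →ₗ[Λ] InvDual Λ M where
  toFun g := InvDual.of ((show N →ₗ[Λ] Λ from g).comp f)
  map_add' _ _ := rfl
  map_smul' _ _ := rfl

@[simp] theorem dualMap_apply (f : M →ₗ[Λ] N) (g : InvDual Λ N) (x : M) :
    dualMap f g x = g (f x) := rfl

variable (Λ M) in
/-- The canonical homomorphism `M → M**`; it is bijective for finitely generated free `M`. -/
def ev : M →ₗ[Λ] InvDual Λ (InvDual Λ M) where
  toFun x := InvDual.of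
    { toFun := fun f => star (f x)
      map_add' := fun f g => by simp
      map_smul' := fun a f => by simp }
  map_add' x y := by ext f; simp
  map_smul' a x := by ext f; simp

@[simp] theorem ev_apply (x : M) (f : InvDual Λ M) : ev Λ M x f = star (f x) := rfl

/-- The adjoint `φ^t : N → M*` of `φ : M → N*`, `φ^t(y)(x) = conj (φ(x)(y))`, i.e. the dual of `φ`
composed with `N → N**`. -/
def adj (φ : M →ₗ[Λ] InvDual Λ N) : N →ₗ[Λ] InvDual Λ M := dualMap φ ∘ₗ ev Λ N

@[simp] theorem adj_apply (φ : M →ₗ[Λ] InvDual Λ N) (y : N) (x : M) :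
    adj φ y x = star (φ x y) := rfl

section Coordinates

variable {ι : Type*} [Fintype ι]

/-- A finite basis of `M` identifies `M*` with `Λ^ι`. -/
noncomputable def dualCoord (b : Module.Basis ι Λ M) : (ι → Λ) ≃ₗ[Λ] InvDual Λ M where
  toFun c := InvDual.of
    { toFun := fun x => ∑ i, b.repr x i * star (c i)
      map_add' := fun x y => by simp [add_mul, Finset.sum_add_distrib]
      map_smul' := fun a x => by simp [Finset.mul_sum, mul_assoc] }
  map_add' c d := by ext x; simp [mul_add, Finset.sum_add_distrib]
  map_smul' a c := by ext x; simp [Finset.sum_mul, mul_assoc]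
  invFun f i := star (f (b i))
  left_inv c := by
    classical
    ext i; simp [Finsupp.single_apply]
  right_inv f := by
    ext x
    have h : f x = f (∑ i, b.repr x i • b i) := by rw [b.sum_repr]
    rw [h, map_sum]
    simp

theorem ev_bijective_of_basis (b : Module.Basis ι Λ M) : Function.Bijective (ev Λ M) := by
  classical
  constructor
  · intro x y h
    apply b.ext_elem
    intro i
    have := DFunLike.congr_fun h (dualCoord b (Pi.single i 1))
    simp only [ev_apply] at this
    have h2 := star_injective this
    simpa [dualCoord, Pi.single_apply, apply_ite] using h2
  · intro φ
    refine ⟨∑ i, star (φ (dualCoord b (Pi.single i 1))) • b i, ?_⟩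
    ext f
    have hf : f = ∑ i, star (f (b i)) • dualCoord b (Pi.single i (1 : Λ)) := by
      apply (dualCoord b).symm.injective
      simp only [map_sum, map_smul, LinearEquiv.symm_apply_apply]
      ext j
      simp [Finset.sum_apply, Pi.single_apply]
      rfl
    have h2 : φ f = ∑ i, star (f (b i)) * φ (dualCoord b (Pi.single i (1 : Λ))) := by
      conv_lhs => rw [hf]
      simp only [map_sum, map_smul, smul_eq_mul]
    rw [h2, ev_apply]
    simp only [map_sum, map_smul, smul_eq_mul, star_sum, star_mul, star_star]

end Coordinates

instance [Module.Free Λ M] [Module.Finite Λ M] : Module.Free Λ (InvDual Λ M) :=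
  Module.Free.of_equiv
    (dualCoord ((Module.Free.chooseBasis Λ M).reindex (Equiv.refl _)))

instance [Module.Free Λ M] [Module.Finite Λ M] : Module.Finite Λ (InvDual Λ M) :=
  Module.Finite.equiv (dualCoord (Module.Free.chooseBasis Λ M))

theorem ev_bijective [Module.Free Λ M] [Module.Finite Λ M] : Function.Bijective (ev Λ M) :=
  ev_bijective_of_basis (Module.Free.chooseBasis Λ M)

end Duality


section Quadratic

variable {Λ : Type*} [Ring Λ] [StarRing Λ]
variable {M N K : Type*} [AddCommGroup M] [Module Λ M] [AddCommGroup N] [Module Λ N]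
  [AddCommGroup K] [Module Λ K]

variable (Λ M) in
/-- The `ε`-duality involution `T_ε φ = ε φ^*` on `Hom_Λ(M, M*)`. -/
def duality (ε : ℤˣ) : (M →ₗ[Λ] InvDual Λ M) →+ (M →ₗ[Λ] InvDual Λ M) where
  toFun φ := ε • adj φ
  map_zero' := by ext; simp
  map_add' φ ψ := by ext; simp

@[simp] theorem duality_apply (ε : ℤˣ) (φ : M →ₗ[Λ] InvDual Λ M) (x y : M) :
    duality Λ M ε φ x y = ε • star (φ y x) := rfl

variable (Λ M) in
/-- `Q_ε(M) = coker (1 - T_ε : Hom_Λ(M, M*) → Hom_Λ(M, M*))`. -/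
abbrev QGroup (ε : ℤˣ) : Type _ :=
  (M →ₗ[Λ] InvDual Λ M) ⧸ (AddMonoidHom.id (M →ₗ[Λ] InvDual Λ M) - duality Λ M ε).range

namespace QGroup

variable {ε : ℤˣ}

/-- The class in `Q_ε(M)` of a homomorphism `M → M*`. -/
def mk (ε : ℤˣ) (φ : M →ₗ[Λ] InvDual Λ M) : QGroup Λ M ε := QuotientAddGroup.mk φ

/-- Pullback `φ ↦ f^* φ f` of homomorphisms `N → N*` along `f : M → N`. -/
def pull (f : M →ₗ[Λ] N) : (N →ₗ[Λ] InvDual Λ N) →+ (M →ₗ[Λ] InvDual Λ M) where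
  toFun φ := dualMap f ∘ₗ φ ∘ₗ f
  map_zero' := by ext; simp
  map_add' φ ψ := by ext; simp

@[simp] theorem pull_apply (f : M →ₗ[Λ] N) (φ : N →ₗ[Λ] InvDual Λ N) (x y : M) :
    pull f φ x y = φ (f x) (f y) := rfl

/-- The induced map `Q_ε(N) → Q_ε(M)`, `[φ] ↦ [f^* φ f]`. -/
def map (f : M →ₗ[Λ] N) : QGroup Λ N ε →+ QGroup Λ M ε :=
  QuotientAddGroup.map _ _ (pull f) (by
    rintro _ ⟨φ, rfl⟩
    exact ⟨pull f φ, by ext; simp⟩)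

@[simp] theorem map_mk (f : M →ₗ[Λ] N) (φ : N →ₗ[Λ] InvDual Λ N) :
    map f (mk ε φ) = mk ε (pull f φ) := rfl

theorem ind {p : QGroup Λ M ε → Prop} (h : ∀ φ, p (mk ε φ)) (x : QGroup Λ M ε) : p x :=
  QuotientAddGroup.induction_on x h

theorem mk_add (φ ψ : M →ₗ[Λ] InvDual Λ M) : mk ε (φ + ψ) = mk ε φ + mk ε ψ := rfl

theorem map_id (x : QGroup Λ M ε) : map LinearMap.id x = x := by
  induction x using ind with | h φ => rfl

theorem map_map (f : M →ₗ[Λ] N) (g : N →ₗ[Λ] K) (x : QGroup Λ K ε) :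
    map f (map g x) = map (g ∘ₗ f) x := by
  induction x using ind with | h φ => rfl

/-- The symmetrization `1 + T_ε : Q_ε(M) → Hom_Λ(M, M*)`. -/
def symm : QGroup Λ M ε →+ (M →ₗ[Λ] InvDual Λ M) :=
  QuotientAddGroup.lift _ (AddMonoidHom.id _ + duality Λ M ε) (by
    rintro _ ⟨φ, rfl⟩
    ext x y
    rcases Int.units_eq_one_or ε with rfl | rfl <;> simp)

theorem symm_mk (φ : M →ₗ[Λ] InvDual Λ M) : symm (mk ε φ) = φ + duality Λ M ε φ := rfl

@[simp] theorem symm_mk_apply (φ : M →ₗ[Λ] InvDual Λ M) (x y : M) :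
    symm (mk ε φ) x y = φ x y + ε • star (φ y x) := rfl

theorem symm_map (f : M →ₗ[Λ] N) (x : QGroup Λ N ε) : symm (map f x) = pull f (symm x) := by
  induction x using ind with | h φ => ext; simp

theorem symm_symm (x : QGroup Λ M ε) (a b : M) : symm x a b = ε • star (symm x b a) := by
  induction x using ind with
  | h φ => rcases Int.units_eq_one_or ε with rfl | rfl <;> simp [add_comm]

end QGroup

variable (Λ) in
/-- The quadratic structure of the hyperbolic `ε`-quadratic form
`H_ε(P) = (P ⊕ P*, (0 1; 0 0))`. -/
def hypMap (P : Type*) [AddCommGroup P] [Module Λ P] :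
    P × InvDual Λ P →ₗ[Λ] InvDual Λ (P × InvDual Λ P) :=
  dualMap (LinearMap.fst Λ P (InvDual Λ P)) ∘ₗ LinearMap.snd Λ P (InvDual Λ P)

@[simp] theorem hypMap_apply (P : Type*) [AddCommGroup P] [Module Λ P]
    (x y : P × InvDual Λ P) : hypMap Λ P x y = x.2 y.1 := rfl

/-- `L ⊆ M` is a lagrangian of the `ε`-quadratic form `(M, ψ)`: a direct summand on which `ψ`
vanishes and which equals its annihilator `ker (j^* (1 + T_ε) ψ)`, `j : L → M` the inclusion. -/
def IsLagrangian {ε : ℤˣ} (ψ : QGroup Λ M ε) (L : Submodule Λ M) : Prop :=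
  (∃ L' : Submodule Λ M, IsCompl L L') ∧ QGroup.map L.subtype ψ = 0 ∧
    LinearMap.ker (dualMap L.subtype ∘ₗ QGroup.symm ψ) = L

end Quadratic

section Sums

variable {Λ : Type*} [Ring Λ] [StarRing Λ] {ε : ℤˣ}
variable {M N K P Q : Type*} [AddCommGroup M] [Module Λ M] [AddCommGroup N] [Module Λ N]
  [AddCommGroup K] [Module Λ K] [AddCommGroup P] [Module Λ P] [AddCommGroup Q] [Module Λ Q]

/-- The orthogonal sum of `ψ ∈ Q_ε(M)` and `ψ' ∈ Q_ε(N)` in `Q_ε(M ⊕ N)`. -/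
def QGroup.sum (x : QGroup Λ M ε) (y : QGroup Λ N ε) : QGroup Λ (M × N) ε :=
  QGroup.map (LinearMap.fst Λ M N) x + QGroup.map (LinearMap.snd Λ M N) y

theorem QGroup.symm_sum_apply (x : QGroup Λ M ε) (y : QGroup Λ N ε) (a b : M × N) :
    QGroup.symm (QGroup.sum x y) a b =
      QGroup.symm x a.1 b.1 + QGroup.symm y a.2 b.2 := by
  rw [QGroup.sum, map_add, QGroup.symm_map, QGroup.symm_map]
  rfl

theorem QGroup.map_sum_congr (e : M →ₗ[Λ] N) (y : QGroup Λ N ε) (z : QGroup Λ K ε) :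
    QGroup.map (e.prodMap LinearMap.id) (QGroup.sum y z) = QGroup.sum (QGroup.map e y) z := by
  rw [QGroup.sum, QGroup.sum, map_add, QGroup.map_map, QGroup.map_map, QGroup.map_map]
  rfl

variable (Λ M N K) in
/-- `(M ⊕ N) ⊕ K = (M ⊕ K) ⊕ N`. -/
def swapEquiv : ((M × N) × K) ≃ₗ[Λ] ((M × K) × N) where
  toFun x := ((x.1.1, x.2), x.1.2)
  invFun x := ((x.1.1, x.2), x.1.2)
  map_add' _ _ := rfl
  map_smul' _ _ := rfl
  left_inv _ := rfl
  right_inv _ := rfl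

theorem QGroup.map_swap (x : QGroup Λ M ε) (y : QGroup Λ N ε) (z : QGroup Λ K ε) :
    QGroup.map (swapEquiv Λ M N K : ((M × N) × K) →ₗ[Λ] ((M × K) × N))
      (QGroup.sum (QGroup.sum x z) y) = QGroup.sum (QGroup.sum x y) z := by
  simp only [QGroup.sum, map_add, QGroup.map_map]
  rw [add_right_comm]
  rfl

variable (Λ M P Q) in
/-- `(M ⊕ (P ⊕ P*)) ⊕ (Q ⊕ Q*) = M ⊕ ((P ⊕ Q) ⊕ (P ⊕ Q)*)`. -/
def hypSumEquiv : ((M × (P × InvDual Λ P)) × (Q × InvDual Λ Q)) ≃ₗ[Λ]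
    (M × ((P × Q) × InvDual Λ (P × Q))) where
  toFun x := (x.1.1, ((x.1.2.1, x.2.1),
    dualMap (LinearMap.fst Λ P Q) x.1.2.2 + dualMap (LinearMap.snd Λ P Q) x.2.2))
  invFun x := ((x.1, (x.2.1.1, dualMap (LinearMap.inl Λ P Q) x.2.2)),
    (x.2.1.2, dualMap (LinearMap.inr Λ P Q) x.2.2))
  map_add' x y := by
    refine Prod.ext rfl (Prod.ext rfl ?_)
    simp only [Prod.fst_add, Prod.snd_add, map_add]
    abel
  map_smul' c x := by
    refine Prod.ext rfl (Prod.ext rfl ?_)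
    simp only [Prod.smul_fst, Prod.smul_snd, map_smul, smul_add, RingHom.id_apply]
  left_inv := by
    rintro ⟨⟨a, p, f⟩, q, g⟩
    refine Prod.ext (Prod.ext rfl (Prod.ext rfl ?_)) (Prod.ext rfl ?_)
    · ext z; simp
    · ext z; simp
  right_inv := by
    rintro ⟨a, ⟨p, q⟩, f⟩
    refine Prod.ext rfl (Prod.ext rfl ?_)
    refine InvDual.ext ?_
    rintro ⟨z, w⟩
    simp only [InvDual.add_apply, dualMap_apply, LinearMap.fst_apply, LinearMap.snd_apply,
      LinearMap.inl_apply, LinearMap.inr_apply]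
    rw [← map_add]
    simp

theorem QGroup.map_hypSum (x : QGroup Λ M ε) :
    QGroup.map (hypSumEquiv Λ M P Q : ((M × (P × InvDual Λ P)) × (Q × InvDual Λ Q)) →ₗ[Λ]
        (M × ((P × Q) × InvDual Λ (P × Q))))
      (QGroup.sum x (QGroup.mk ε (hypMap Λ (P × Q)))) =
    QGroup.sum (QGroup.sum x (QGroup.mk ε (hypMap Λ P))) (QGroup.mk ε (hypMap Λ Q)) := by
  simp only [QGroup.sum, map_add, QGroup.map_map, QGroup.map_mk, add_assoc]
  rw [← QGroup.mk_add]
  congr 1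

theorem QGroup.sum_bijective {x : QGroup Λ M ε} {y : QGroup Λ N ε}
    (hx : Function.Bijective (QGroup.symm x)) (hy : Function.Bijective (QGroup.symm y)) :
    Function.Bijective (QGroup.symm (QGroup.sum x y)) := by
  constructor
  · rw [injective_iff_map_eq_zero]
    rintro ⟨a, b⟩ h
    have h1 : QGroup.symm x a = 0 := by
      ext z
      have := DFunLike.congr_fun h ((z, 0) : M × N)
      rw [QGroup.symm_sum_apply] at this
      simpa using this
    have h2 : QGroup.symm y b = 0 := by
      ext z
      have := DFunLike.congr_fun h ((0, z) : M × N)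
      rw [QGroup.symm_sum_apply] at this
      simpa using this
    rw [(injective_iff_map_eq_zero _).1 hx.1 a h1, (injective_iff_map_eq_zero _).1 hy.1 b h2]
    rfl
  · intro f
    obtain ⟨a, ha⟩ := hx.2 (dualMap (LinearMap.inl Λ M N) f)
    obtain ⟨b, hb⟩ := hy.2 (dualMap (LinearMap.inr Λ M N) f)
    refine ⟨(a, b), ?_⟩
    ext ⟨c, d⟩
    rw [QGroup.symm_sum_apply]
    simp only [ha, hb, dualMap_apply, LinearMap.inl_apply, LinearMap.inr_apply]
    rw [← map_add]
    simp

theorem QGroup.hyp_bijective [Module.Free Λ P] [Module.Finite Λ P] :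
    Function.Bijective (QGroup.symm (QGroup.mk ε (hypMap Λ P))) := by
  constructor
  · rw [injective_iff_map_eq_zero]
    rintro ⟨x, f⟩ h
    have h1 : f = 0 := by
      ext z
      simpa using DFunLike.congr_fun h ((z, 0) : P × InvDual Λ P)
    have h2 : x = 0 := by
      apply (ev_bijective (Λ := Λ) (M := P)).1
      ext g
      have := DFunLike.congr_fun h ((0, g) : P × InvDual Λ P)
      rcases Int.units_eq_one_or ε with rfl | rfl <;> simpa [h1] using this
    rw [h1, h2]
    rfl
  · intro φ
    obtain ⟨x, hx⟩ := (ev_bijective (Λ := Λ) (M := P)).2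
      (ε • dualMap (LinearMap.inr Λ P (InvDual Λ P)) φ)
    refine ⟨(x, dualMap (LinearMap.inl Λ P (InvDual Λ P)) φ), ?_⟩
    ext ⟨a, g⟩
    have hg : star (g x) = ε • φ (0, g) := by
      simpa using DFunLike.congr_fun hx g
    simp only [QGroup.symm_mk_apply, hypMap_apply, dualMap_apply, LinearMap.inl_apply, hg,
      smul_smul, Int.units_mul_self, one_smul]
    rw [← map_add]
    simp

end Sums

section LGroup

/-- Finitely generated free left `Λ`-modules. -/
structure FreeMod (Λ : Type u) [Ring Λ] : Type (u + 1) where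
  carrier : Type u
  [addCommGroup : AddCommGroup carrier]
  [module : Module Λ carrier]
  [free : Module.Free Λ carrier]
  [finite : Module.Finite Λ carrier]

attribute [instance] FreeMod.addCommGroup FreeMod.module FreeMod.free FreeMod.finite

/-- Non-singular `ε`-quadratic forms `(M, ψ ∈ Q_ε(M))` on finitely generated free modules. -/
structure NSForm (Λ : Type u) [Ring Λ] [StarRing Λ] (ε : ℤˣ) : Type (u + 1) where
  M : Type u
  [addCommGroup : AddCommGroup M]
  [module : Module Λ M]
  [free : Module.Free Λ M]
  [finite : Module.Finite Λ M]
  psi : QGroup Λ M ε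
  nonsing : Function.Bijective (QGroup.symm psi)

attribute [instance] NSForm.addCommGroup NSForm.module NSForm.free NSForm.finite

namespace NSForm

variable {Λ : Type u} [Ring Λ] [StarRing Λ] {ε : ℤˣ}

/-- Isometry of `ε`-quadratic forms. -/
def Isometric (A B : NSForm Λ ε) : Prop :=
  ∃ e : A.M ≃ₗ[Λ] B.M, QGroup.map (e : A.M →ₗ[Λ] B.M) B.psi = A.psi

/-- Orthogonal sum of forms. -/
def sum (A B : NSForm Λ ε) : NSForm Λ ε where
  M := A.M × B.M
  psi := QGroup.sum A.psi B.psi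
  nonsing := QGroup.sum_bijective A.nonsing B.nonsing

/-- The hyperbolic form `H_ε(P)`. -/
def hyp (ε : ℤˣ) (P : FreeMod Λ) : NSForm Λ ε where
  M := P.carrier × InvDual Λ P.carrier
  psi := QGroup.mk ε (hypMap Λ P.carrier)
  nonsing := QGroup.hyp_bijective

theorem Isometric.refl (A : NSForm Λ ε) : Isometric A A :=
  ⟨LinearEquiv.refl Λ A.M, QGroup.map_id _⟩

theorem Isometric.symm {A B : NSForm Λ ε} (h : Isometric A B) : Isometric B A := by
  obtain ⟨e, he⟩ := h
  refine ⟨e.symm, ?_⟩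
  rw [← he, QGroup.map_map]
  simpa using QGroup.map_id B.psi

theorem Isometric.trans {A B C : NSForm Λ ε} (h : Isometric A B) (h2 : Isometric B C) :
    Isometric A C := by
  obtain ⟨e, he⟩ := h
  obtain ⟨f, hf⟩ := h2
  refine ⟨e.trans f, ?_⟩
  rw [← he, ← hf, QGroup.map_map]
  rfl

theorem Isometric.sum_right {A B : NSForm Λ ε} (h : Isometric A B) (C : NSForm Λ ε) :
    Isometric (A.sum C) (B.sum C) := by
  obtain ⟨e, he⟩ := h
  refine ⟨LinearEquiv.prodCongr e (LinearEquiv.refl Λ C.M), ?_⟩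
  refine (QGroup.map_sum_congr (e : A.M →ₗ[Λ] B.M) B.psi C.psi).trans ?_
  rw [he]
  rfl

theorem Isometric.sum_swap (A B C : NSForm Λ ε) :
    Isometric ((A.sum B).sum C) ((A.sum C).sum B) :=
  ⟨swapEquiv Λ A.M B.M C.M, QGroup.map_swap A.psi B.psi C.psi⟩

/-- The sum of two finitely generated free modules. -/
def _root_.SurgeryL.FreeMod.prod (P Q : FreeMod Λ) : FreeMod Λ where
  carrier := P.carrier × Q.carrier

theorem Isometric.sum_hyp (A : NSForm Λ ε) (P Q : FreeMod Λ) :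
    Isometric ((A.sum (hyp ε P)).sum (hyp ε Q)) (A.sum (hyp ε (P.prod Q))) :=
  ⟨hypSumEquiv Λ A.M P.carrier Q.carrier, QGroup.map_hypSum A.psi⟩

/-- Two forms are equivalent if they become isometric after addition of hyperbolic forms on
finitely generated free modules. -/
def WittEquiv (A B : NSForm Λ ε) : Prop :=
  ∃ P Q : FreeMod Λ, Isometric (A.sum (hyp ε P)) (B.sum (hyp ε Q))

theorem wittEquiv_equivalence : Equivalence (WittEquiv (Λ := Λ) (ε := ε)) where
  refl A := ⟨⟨PUnit⟩, ⟨PUnit⟩, Isometric.refl _⟩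
  symm := fun ⟨P, Q, h⟩ => ⟨Q, P, h.symm⟩
  trans := by
    rintro A B C ⟨P, P2, h⟩ ⟨Q, Q2, k⟩
    refine ⟨P.prod Q, Q2.prod P2, ?_⟩
    refine (Isometric.sum_hyp A P Q).symm.trans ?_
    refine (h.sum_right _).trans ?_
    refine (Isometric.sum_swap _ _ _).trans ?_
    exact (k.sum_right _).trans (Isometric.sum_hyp C Q2 P2)

instance wittSetoid (Λ : Type u) [Ring Λ] [StarRing Λ] (ε : ℤˣ) : Setoid (NSForm Λ ε) :=
  ⟨WittEquiv, wittEquiv_equivalence⟩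

end NSForm

/-- The (underlying pointed set of the) Witt group of non-singular `ε`-quadratic forms on
finitely generated free `Λ`-modules; for `ε = (-1)^k` this is the quadratic `L`-group
`L_{2k}(Λ)`. -/
def LGroup (Λ : Type u) [Ring Λ] [StarRing Λ] (ε : ℤˣ) : Type (u + 1) :=
  Quotient (NSForm.wittSetoid Λ ε)

/-- The zero of the Witt group: the class of the form on the zero module. -/
instance (Λ : Type u) [Ring Λ] [StarRing Λ] (ε : ℤˣ) : Zero (LGroup Λ ε) :=
  ⟨Quotient.mk _ (NSForm.hyp ε ⟨PUnit⟩)⟩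

end LGroup

section Preformations

/-- A regular `ε`-quadratic split preformation `(F ←γ- G -μ→ F*, θ)`: finitely generated free
modules `F`, `G` and `θ ∈ Q_{-ε}(G)` such that `γ^* μ` is the symmetrization of `θ`, i.e.
`(G, γ^* μ, θ)` is a `(-ε)`-quadratic form. -/
structure Preformation (Λ : Type u) [Ring Λ] [StarRing Λ] (ε : ℤˣ) : Type (u + 1) where
  F : Type u
  G : Type u
  [addCommGroupF : AddCommGroup F]
  [moduleF : Module Λ F]
  [freeF : Module.Free Λ F]
  [finiteF : Module.Finite Λ F]
  [addCommGroupG : AddCommGroup G]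
  [moduleG : Module Λ G]
  [freeG : Module.Free Λ G]
  [finiteG : Module.Finite Λ G]
  gamma : G →ₗ[Λ] F
  mu : G →ₗ[Λ] InvDual Λ F
  theta : QGroup Λ G (-ε)
  compat : QGroup.symm theta = dualMap gamma ∘ₗ mu

attribute [instance] Preformation.addCommGroupF Preformation.moduleF Preformation.freeF
  Preformation.finiteF Preformation.addCommGroupG Preformation.moduleG Preformation.freeG
  Preformation.finiteG

namespace Preformation

variable {Λ : Type u} [Ring Λ] [StarRing Λ] {ε : ℤˣ}

theorem mu_gamma (z : Preformation Λ ε) (x y : z.G) :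
    z.mu x (z.gamma y) = -(ε • star (z.mu y (z.gamma x))) := by
  have h := QGroup.symm_symm z.theta x y
  rw [z.compat] at h
  simpa only [LinearMap.comp_apply, dualMap_apply, Units.neg_smul] using h

/-- The sum of two preformations. -/
def sum (z z' : Preformation Λ ε) : Preformation Λ ε where
  F := z.F × z'.F
  G := z.G × z'.G
  gamma := z.gamma.prodMap z'.gamma
  mu := dualMap (LinearMap.fst Λ z.F z'.F) ∘ₗ z.mu ∘ₗ LinearMap.fst Λ z.G z'.G +
    dualMap (LinearMap.snd Λ z.F z'.F) ∘ₗ z'.mu ∘ₗ LinearMap.snd Λ z.G z'.G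
  theta := QGroup.sum z.theta z'.theta
  compat := by
    refine LinearMap.ext fun x => InvDual.ext fun y => ?_
    rw [QGroup.symm_sum_apply, z.compat, z'.compat]
    rfl

/-- The boundary `∂(K, θ) = (K ←1- K -θ-εθ^*→ K*, θ)` of a `(-ε)`-quadratic form `(K, θ)`. -/
def boundary (K : FreeMod Λ) (θ : QGroup Λ K.carrier (-ε)) : Preformation Λ ε where
  F := K.carrier
  G := K.carrier
  gamma := LinearMap.id
  mu := QGroup.symm θ
  theta := θ
  compat := rfl

/-- The boundary `∂H_{-ε}(P)` of the hyperbolic `(-ε)`-quadratic form on `P`. -/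
def boundaryHyp (ε : ℤˣ) (P : FreeMod Λ) : Preformation Λ ε :=
  boundary ⟨P.carrier × InvDual Λ P.carrier⟩ (QGroup.mk (-ε) (hypMap Λ P.carrier))

/-- The flip `(F* ←εμ- G -γ→ F = F**, -θ)` of `(F ←γ- G -μ→ F*, θ)`. -/
def flip (z : Preformation Λ ε) : Preformation Λ ε where
  F := InvDual Λ z.F
  G := z.G
  gamma := ε • z.mu
  mu := ev Λ z.F ∘ₗ z.gamma
  theta := -z.theta
  compat := by
    refine LinearMap.ext fun x => InvDual.ext fun y => ?_
    rw [map_neg, z.compat]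
    simp only [LinearMap.neg_apply, InvDual.neg_apply, LinearMap.comp_apply, dualMap_apply,
      ev_apply, LinearMap.smul_apply, InvDual.units_smul_apply, z.mu_gamma x y, neg_neg]
    rcases Int.units_eq_one_or ε with rfl | rfl <;> simp

/-- A strong isomorphism `(α, β)` of preformations: `γ'β = αγ`, `μ'β = α^{-*}μ` and
`θ = β^*θ'β ∈ Q_{-ε}(G)`. -/
structure StrongIso (z z' : Preformation Λ ε) where
  alpha : z.F ≃ₗ[Λ] z'.F
  beta : z.G ≃ₗ[Λ] z'.G
  gamma_comm : (alpha : z.F →ₗ[Λ] z'.F) ∘ₗ z.gamma = z'.gamma ∘ₗ (beta : z.G →ₗ[Λ] z'.G)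
  mu_comm : dualMap (alpha.symm : z'.F →ₗ[Λ] z.F) ∘ₗ z.mu = z'.mu ∘ₗ (beta : z.G →ₗ[Λ] z'.G)
  theta_comm : z.theta = QGroup.map (beta : z.G →ₗ[Λ] z'.G) z'.theta

/-- `z` and `z'` are stably strongly isomorphic, i.e. `[z] = [z']` in the `l`-monoid: they become
strongly isomorphic after addition of boundaries of hyperbolic forms. -/
def StablyStronglyIso (z z' : Preformation Λ ε) : Prop :=
  ∃ P P' : FreeMod Λ, Nonempty (StrongIso (z.sum (boundaryHyp ε P)) (z'.sum (boundaryHyp ε P')))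

/-- `U ⊆ G` is an `h`-lagrangian. The last condition says that restriction of functionals induces
an isomorphism `F*/μ(U) → γ(U)^*`. -/
structure IsHLagrangian (z : Preformation Λ ε) (U : Submodule Λ z.G) : Prop where
  free : Module.Free Λ U
  finite : Module.Finite Λ U
  symm_zero : dualMap U.subtype ∘ₗ dualMap z.gamma ∘ₗ z.mu ∘ₗ U.subtype = 0
  theta_zero : QGroup.map U.subtype z.theta = 0
  gamma_injOn : Function.Injective (z.gamma ∘ₗ U.subtype)
  mu_injOn : Function.Injective (z.mu ∘ₗ U.subtype)
  gamma_summand : ∃ V : Submodule Λ z.F, IsCompl (U.map z.gamma) V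
  mu_summand : ∃ V : Submodule Λ (InvDual Λ z.F), IsCompl (U.map z.mu) V
  restrict_bijective : ∃ h : U.map z.mu ≤ LinearMap.ker (dualMap (U.map z.gamma).subtype),
    Function.Bijective ((U.map z.mu).liftQ (dualMap (U.map z.gamma).subtype) h)

/-- A preformation is elementary if it has an `h`-lagrangian. -/
def IsElementary (z : Preformation Λ ε) : Prop := ∃ U : Submodule Λ z.G, z.IsHLagrangian U

/-- The class `[z]` in the `l`-monoid `l_{2q+2}(Λ)` (where `ε = (-1)^q`) is elementary, i.e. it has
an elementary representative. -/
def ClassIsElementary (z : Preformation Λ ε) : Prop :=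
  ∃ z' : Preformation Λ ε, StablyStronglyIso z' z ∧ z'.IsElementary

/-- `z` is a non-singular formation: `(γ, μ) : G → F ⊕ F*` is the inclusion of a lagrangian of the
hyperbolic `ε`-quadratic form `H_ε(F)`. -/
def IsNonsingularFormation (z : Preformation Λ ε) : Prop :=
  Function.Injective (z.gamma.prod z.mu) ∧
    IsLagrangian (QGroup.mk ε (hypMap Λ z.F)) (LinearMap.range (z.gamma.prod z.mu))

/-- A weak isomorphism `(α, β, ν)` of preformations, `ν ∈ Q_{-ε}(F*)`. The first condition is
`αγ + α(ν - εν^*)^* μ = γ'β : G → F'`, written in `F'** = F'` (recall that `ν - εν^*` maps `F*` to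
`F** = F`); the others are `α^{-*}μ = μ'β` and `θ + μ^*νμ = β^*θ'β`. -/
structure WeakIso (z z' : Preformation Λ ε) where
  alpha : z.F ≃ₗ[Λ] z'.F
  beta : z.G ≃ₗ[Λ] z'.G
  nu : QGroup Λ (InvDual Λ z.F) (-ε)
  gamma_comm : ev Λ z'.F ∘ₗ (alpha : z.F →ₗ[Λ] z'.F) ∘ₗ z.gamma +
      dualMap (dualMap (alpha : z.F →ₗ[Λ] z'.F)) ∘ₗ adj (QGroup.symm nu) ∘ₗ z.mu =
    ev Λ z'.F ∘ₗ z'.gamma ∘ₗ (beta : z.G →ₗ[Λ] z'.G)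
  mu_comm : dualMap (alpha.symm : z'.F →ₗ[Λ] z.F) ∘ₗ z.mu = z'.mu ∘ₗ (beta : z.G →ₗ[Λ] z'.G)
  theta_comm : z.theta + QGroup.map z.mu nu = QGroup.map (beta : z.G →ₗ[Λ] z'.G) z'.theta

/-- A flip-isomorphism of `z`: a weak isomorphism of `z` with its flip. -/
abbrev FlipIso (z : Preformation Λ ε) := WeakIso z z.flip

/-- The isomorphism `α : F → F*` of a flip-isomorphism `t = (α, β, ν)`. For the flip of `z`, the
conditions above read `αγ + α(ν - εν^*)^* μ = εμβ`, `α^{-*}μ = γβ` and `θ + μ^*νμ + β^*θβ = 0`. -/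
def FlipIso.a {z : Preformation Λ ε} (t : z.FlipIso) : z.F ≃ₗ[Λ] InvDual Λ z.F := t.alpha

/-- The isomorphism `β : G → G` of a flip-isomorphism. -/
def FlipIso.b {z : Preformation Λ ε} (t : z.FlipIso) : z.G ≃ₗ[Λ] z.G := t.beta

end Preformation

/-- The homomorphism `M → M*` with a single matrix entry `A : N → K*`, for `p : M → N` (column) and
`r : M → K` (row) the projections. -/
def entry {Λ : Type*} [Ring Λ] [StarRing Λ] {M N K : Type*} [AddCommGroup M] [Module Λ M]
    [AddCommGroup N] [Module Λ N] [AddCommGroup K] [Module Λ K]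
    (r : M →ₗ[Λ] K) (p : M →ₗ[Λ] N) (A : N →ₗ[Λ] InvDual Λ K) : M →ₗ[Λ] InvDual Λ M :=
  dualMap r ∘ₗ A ∘ₗ p

@[simp] theorem entry_apply {Λ : Type*} [Ring Λ] [StarRing Λ] {M N K : Type*} [AddCommGroup M]
    [Module Λ M] [AddCommGroup N] [Module Λ N] [AddCommGroup K] [Module Λ K]
    (r : M →ₗ[Λ] K) (p : M →ₗ[Λ] N) (A : N →ₗ[Λ] InvDual Λ K) (x y : M) :
    entry r p A x y = A (p x) (r y) := rfl

namespace Preformation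

variable {Λ : Type u} [Ring Λ] [StarRing Λ] {ε : ℤˣ}

/-- The matrix `X = (θ 0; γt^*μ θt) : G ⊕ G* → (G ⊕ G*)^*`. -/
def extMatrix (z : Preformation Λ ε) (θ : z.G →ₗ[Λ] InvDual Λ z.G)
    (γt : InvDual Λ z.G →ₗ[Λ] z.F) (θt : InvDual Λ z.G →ₗ[Λ] InvDual Λ (InvDual Λ z.G)) :
    z.G × InvDual Λ z.G →ₗ[Λ] InvDual Λ (z.G × InvDual Λ z.G) :=
  entry (LinearMap.fst Λ _ _) (LinearMap.fst Λ _ _) θ +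
    entry (LinearMap.snd Λ _ _) (LinearMap.fst Λ _ _) (dualMap γt ∘ₗ z.mu) +
    entry (LinearMap.snd Λ _ _) (LinearMap.snd Λ _ _) θt

/-- An extension of `(γ, μ)` to an isometry of hyperbolic `ε`-quadratic forms
`(f, X) : H_ε(G) → H_ε(F)` with `f = (γ γt; μ μt)` and `X = (θ 0; γt^*μ θt)`, where `θ` is a
representative of the class `θ ∈ Q_{-ε}(G)`: an isomorphism `f` with
`f^* (0 1; 0 0) f - (0 1; 0 0) = X - ε X^*`. -/
structure Extension (z : Preformation Λ ε) where
  theta : z.G →ₗ[Λ] InvDual Λ z.G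
  theta_mk : QGroup.mk (-ε) theta = z.theta
  gammaT : InvDual Λ z.G →ₗ[Λ] z.F
  muT : InvDual Λ z.G →ₗ[Λ] InvDual Λ z.F
  thetaT : InvDual Λ z.G →ₗ[Λ] InvDual Λ (InvDual Λ z.G)
  bijective : Function.Bijective ((z.gamma.coprod gammaT).prod (z.mu.coprod muT))
  isometry :
    QGroup.pull ((z.gamma.coprod gammaT).prod (z.mu.coprod muT)) (hypMap Λ z.F) - hypMap Λ z.G =
      extMatrix z theta gammaT thetaT - duality Λ _ ε (extMatrix z theta gammaT thetaT)

/-- The module `M = G* ⊕ G ⊕ F` carrying the quadratic signature form. -/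
abbrev SigModule (z : Preformation Λ ε) : Type u := InvDual Λ z.G × z.G × z.F

/-- The projections of `M = G* ⊕ G ⊕ F`. -/
abbrev sigPr1 (z : Preformation Λ ε) : z.SigModule →ₗ[Λ] InvDual Λ z.G := LinearMap.fst Λ _ _

/-- The projections of `M = G* ⊕ G ⊕ F`. -/
abbrev sigPr2 (z : Preformation Λ ε) : z.SigModule →ₗ[Λ] z.G :=
  LinearMap.fst Λ _ _ ∘ₗ LinearMap.snd Λ _ _

/-- The projections of `M = G* ⊕ G ⊕ F`. -/
abbrev sigPr3 (z : Preformation Λ ε) : z.SigModule →ₗ[Λ] z.F :=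
  LinearMap.snd Λ _ _ ∘ₗ LinearMap.snd Λ _ _

/-- The matrix
`ξ = (γt^*μt + γt^*ανα^*γt, -γt^*αγ, 0; 0, εθ^*, 0; ε(α^*γt - μt), -μ, 0) : M → M*`,
`M = G* ⊕ G ⊕ F`, for an extension `γt, μt, θt`, a flip-isomorphism `(α, β, ν)` and a
representative `ν : F* → F** = F`. Note that `γt^*ανα^*γt` is `ν` pulled back along
`α^*γt : G* → F*`. -/
def sigMap (z : Preformation Λ ε) (t : z.FlipIso) (e : z.Extension)
    (ν : InvDual Λ z.F →ₗ[Λ] InvDual Λ (InvDual Λ z.F)) :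
    z.SigModule →ₗ[Λ] InvDual Λ z.SigModule :=
  entry z.sigPr1 z.sigPr1
      (dualMap e.gammaT ∘ₗ e.muT +
        QGroup.pull (adj (t.a : z.F →ₗ[Λ] InvDual Λ z.F) ∘ₗ e.gammaT) ν) +
    entry z.sigPr1 z.sigPr2
      (-(dualMap e.gammaT ∘ₗ (t.a : z.F →ₗ[Λ] InvDual Λ z.F) ∘ₗ z.gamma)) +
    entry z.sigPr2 z.sigPr2 (ε • adj e.theta) +
    entry z.sigPr3 z.sigPr1
      (ε • (adj (t.a : z.F →ₗ[Λ] InvDual Λ z.F) ∘ₗ e.gammaT - e.muT)) +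
    entry z.sigPr3 z.sigPr2 (-z.mu)

/-- The linear system behind the non-singularity of the quadratic signature form. -/
theorem signature_solve {F F' G G' : Type*} [AddCommGroup F] [AddCommGroup F'] [AddCommGroup G]
    [AddCommGroup G'] (ε : ℤˣ) (γ : G →+ F) (μ : G →+ F') (γt : G' →+ F) (μt : G' →+ F')
    (gs : F' →+ G') (ms : F →+ G') (gts : F' →+ G) (mts : F →+ G) (a : F →+ F') (aT : F ≃+ F')
    (aN : F' →+ F') (β : G ≃+ G)
    (h1 : ∀ x, gs (μt x) + ε • ms (γt x) = x)
    (h2 : ∀ g, ms (γ g) = -(ε • gs (μ g)))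
    (h3 : ∀ x, mts (γt x) = -(ε • gts (μt x)))
    (h4 : ∀ g, mts (γ g) + ε • gts (μ g) = g)
    (hf : ∀ u, ∃ g x, γ g + γt x = u ∧ μ g + μt x = 0)
    (h7 : ∀ g, a (γ g) = ε • aN (μ g) + ε • μ (β g))
    (h8 : ∀ g, aT (γ (β g)) = μ g)
    (p : G) (q : G') (r : F') :
    ∃ (x : G') (y : G) (w : F),
      gts (μt x) + gts (μt x) + gts (aN (aT (γt x))) - gts (a (γ y)) + mts w - gts (a w) = p ∧
      ε • gs (aT (γt x)) - gs (μ y) + ε • ms w = q ∧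
      ε • (aT (γt x) - μt x) - μ y = r := by
  have h56 : ∀ u, γ (mts u) + ε • γt (ms u) = u ∧ μ (mts u) + ε • μt (ms u) = 0 := by
    intro u
    obtain ⟨g, x, hu, h0⟩ := hf u
    have e1 := h1 x
    have e2 := h2 g
    have e3 := h3 x
    have e4 := h4 g
    have e5 : gts (μ g) = -gts (μt x) := by
      rw [← map_neg, ← eq_neg_of_add_eq_zero_left h0]
    have e6 : gs (μ g) = -gs (μt x) := by
      rw [← map_neg, ← eq_neg_of_add_eq_zero_left h0]
    have m1 : mts u = g := by
      rw [← hu, map_add, e3]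
      rw [e5] at e4
      rcases Int.units_eq_one_or ε with rfl | rfl <;>
        simp only [one_smul, Units.neg_smul] at * <;> grind
    have m2 : ms u = ε • x := by
      rw [← hu, map_add, e2, e6]
      rcases Int.units_eq_one_or ε with rfl | rfl <;>
        simp only [one_smul, Units.neg_smul] at * <;> grind
    rw [m1, m2, ← hu, ← h0]
    rcases Int.units_eq_one_or ε with rfl | rfl <;> simp
  have h5 := fun u => (h56 u).1
  have h6 := fun u => (h56 u).2
  clear h56
  obtain ⟨R, hR⟩ : ∃ R, R = ε • (q - gs r) := ⟨_, rfl⟩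
  obtain ⟨s, hs⟩ : ∃ s, s = -aT.symm (r + ε • μt R) := ⟨_, rfl⟩
  obtain ⟨t, ht⟩ : ∃ t, t = p - mts s - gts (aN (μt R) + ε • aN r - ε • a (γt R)) := ⟨_, rfl⟩
  obtain ⟨h, hh⟩ : ∃ h, h = s + γ t + ε • γt R := ⟨_, rfl⟩
  obtain ⟨x, hx⟩ : ∃ x, x = R - ms h := ⟨_, rfl⟩
  obtain ⟨w, hw⟩ : ∃ w, w = h + ε • γt x := ⟨_, rfl⟩
  obtain ⟨k, hk⟩ : ∃ k, β k = mts h - t := ⟨β.symm (mts h - t), β.apply_symm_apply _⟩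
  refine ⟨x, k - mts h, w, ?_, ?_, ?_⟩
  all_goals
    have A1 := h5 h
    have A2 := h6 h
    have hms : ms h = R - x := by rw [hx]; abel
    rw [hms] at A1 A2
    have hat : aT s = -(r + ε • μt R) := by rw [hs, map_neg, aT.apply_symm_apply]
    have B1 : γ (β k) = ε • γt x + s := by
      rw [hk, map_sub]
      rcases Int.units_eq_one_or ε with rfl | rfl <;>
        simp only [one_smul, Units.neg_smul, map_sub, neg_neg] at * <;> grind
    have B2 : μ k = ε • aT (γt x) - (r + ε • μt R) := by
      rw [← h8, B1, map_add, hat]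
      rcases Int.units_eq_one_or ε with rfl | rfl <;>
        simp only [one_smul, Units.neg_smul, map_neg] <;> abel
    have B3 : μ (mts h) = ε • μt x - ε • μt R := by
      rcases Int.units_eq_one_or ε with rfl | rfl <;>
        simp only [one_smul, Units.neg_smul, map_sub] at * <;> grind
  · have C1 := h4 (β k)
    have C2 := h7 (k - mts h)
    have C3 := h7 (mts h)
    have C4 := h3 x
    have D1 : w = γ (mts h) + ε • γt R := by
      rcases Int.units_eq_one_or ε with rfl | rfl <;>
        simp only [one_smul, Units.neg_smul, map_sub] at * <;> grind
    have D2 : μ (k - mts h) = ε • (aT (γt x) - μt x) - r := by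
      rw [map_sub, B2, B3]
      rcases Int.units_eq_one_or ε with rfl | rfl <;>
        simp only [one_smul, Units.neg_smul] <;> abel
    have D3 : a w = ε • aN (μ (mts h)) + ε • μ (β (mts h)) + ε • a (γt R) := by
      rw [D1, map_add, C3]
      rcases Int.units_eq_one_or ε with rfl | rfl <;>
        simp only [one_smul, Units.neg_smul, map_neg]
    have D4 : mts w = mts h + ε • mts (γt x) := by
      rw [hw, map_add]
      rcases Int.units_eq_one_or ε with rfl | rfl <;>
        simp only [one_smul, Units.neg_smul, map_neg]
    rw [C2, D3, D4, D2, B3, C4]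
    rw [B1, hk] at C1
    simp only [map_sub, hk] at *
    rcases Int.units_eq_one_or ε with rfl | rfl <;>
      simp only [one_smul, Units.neg_smul, map_sub, map_add, map_neg] at * <;> grind
  · have D1 : w = γ (mts h) + ε • γt R := by
      rcases Int.units_eq_one_or ε with rfl | rfl <;>
        simp only [one_smul, Units.neg_smul, map_sub] at * <;> grind
    have E1 := h1 R
    have E2 := h2 (mts h)
    rw [D1, map_sub, B2, B3, map_add, E2, B3]
    rcases Int.units_eq_one_or ε with rfl | rfl <;>
      simp only [one_smul, Units.neg_smul, map_sub, map_add, map_neg] at * <;> grind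
  · rw [map_sub, B2, B3]
    rcases Int.units_eq_one_or ε with rfl | rfl <;>
      simp only [one_smul, Units.neg_smul] <;> abel

end Preformation

theorem QGroup.injective_of_surjective {Λ : Type*} [Ring Λ] [StarRing Λ] {ε : ℤˣ} {M : Type*}
    [AddCommGroup M] [Module Λ M] [Module.Free Λ M] [Module.Finite Λ M] (x : QGroup Λ M ε)
    (h : Function.Surjective (QGroup.symm x)) : Function.Injective (QGroup.symm x) := by
  rw [injective_iff_map_eq_zero]
  intro a ha
  apply (ev_bijective (Λ := Λ) (M := M)).1
  ext φ
  obtain ⟨b, rfl⟩ := h φ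
  rw [ev_apply, QGroup.symm_symm, ha]
  simp

namespace Preformation

variable {Λ : Type u} [Ring Λ] [StarRing Λ] {ε : ℤˣ}

theorem FlipIso.mu_eq {z : Preformation Λ ε} (t : z.FlipIso) (g : z.G) :
    adj (t.a : z.F →ₗ[Λ] InvDual Λ z.F) (z.gamma (t.b g)) = z.mu g := by
  ext u
  have h := DFunLike.congr_fun (DFunLike.congr_fun t.mu_comm g) (t.alpha u)
  change z.mu g (t.alpha.symm (t.alpha u)) = star (t.a u (z.gamma (t.b g))) at h
  rw [LinearEquiv.symm_apply_apply] at h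
  rw [h]
  rfl

theorem FlipIso.gamma_eq {z : Preformation Λ ε} (t : z.FlipIso) (g : z.G) :
    t.a (z.gamma g) =
      ε • dualMap (adj (t.a : z.F →ₗ[Λ] InvDual Λ z.F)) (QGroup.symm t.nu (z.mu g)) +
        ε • z.mu (t.b g) := by
  ext u
  have h := DFunLike.congr_fun (DFunLike.congr_fun t.gamma_comm g) (ev Λ z.F u)
  change star (star (t.a (z.gamma g) u)) +
    star (QGroup.symm t.nu (adj (t.a : z.F →ₗ[Λ] InvDual Λ z.F) u) (z.mu g)) =
    star (star ((ε • z.mu (t.b g)) u)) at h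
  have h2 := QGroup.symm_symm t.nu (z.mu g) (adj (t.a : z.F →ₗ[Λ] InvDual Λ z.F) u)
  simp only [star_star] at h
  simp only [InvDual.add_apply, InvDual.units_smul_apply, dualMap_apply, h2] at h ⊢
  rw [← h]
  rcases Int.units_eq_one_or ε with rfl | rfl <;> simp

theorem Extension.isometry_apply {z : Preformation Λ ε} (e : z.Extension)
    (g g' : z.G) (x x' : InvDual Λ z.G) :
    (z.mu g + e.muT x) (z.gamma g' + e.gammaT x') - x g' =
      (e.theta g g' + z.mu g (e.gammaT x') + e.thetaT x x') -
        ε • star (e.theta g' g + z.mu g' (e.gammaT x) + e.thetaT x' x) := by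
  exact DFunLike.congr_fun (DFunLike.congr_fun e.isometry (g, x)) (g', x')

theorem Extension.eq1 {z : Preformation Λ ε} (e : z.Extension) (x : InvDual Λ z.G) :
    dualMap z.gamma (e.muT x) + ε • adj z.mu (e.gammaT x) = x := by
  ext g
  have h := e.isometry_apply 0 g x 0
  simp only [map_zero, zero_add, add_zero, InvDual.zero_apply, zero_sub] at h
  simp only [InvDual.add_apply, dualMap_apply, InvDual.units_smul_apply, adj_apply]
  rw [sub_eq_iff_eq_add] at h
  rw [h]
  abel

theorem Extension.eq3 {z : Preformation Λ ε} (e : z.Extension) (x : InvDual Λ z.G) :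
    adj e.muT (e.gammaT x) = -(ε • dualMap e.gammaT (e.muT x)) := by
  ext y
  have h := e.isometry_apply 0 0 x y
  have h2 := e.isometry_apply 0 0 y x
  simp only [map_zero, zero_add, InvDual.zero_apply, sub_zero] at h h2
  simp only [adj_apply, InvDual.neg_apply, InvDual.units_smul_apply, dualMap_apply, h, h2]
  rcases Int.units_eq_one_or ε with rfl | rfl <;> simp [add_comm]

theorem sigMap_apply (z : Preformation Λ ε) (t : z.FlipIso) (e : z.Extension)
    (ν : InvDual Λ z.F →ₗ[Λ] InvDual Λ (InvDual Λ z.F)) (x x' : InvDual Λ z.G) (y y' : z.G)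
    (w w' : z.F) :
    sigMap z t e ν (x, y, w) (x', y', w') =
      e.muT x (e.gammaT x') +
        ν (adj (t.a : z.F →ₗ[Λ] InvDual Λ z.F) (e.gammaT x))
          (adj (t.a : z.F →ₗ[Λ] InvDual Λ z.F) (e.gammaT x')) +
        -t.a (z.gamma y) (e.gammaT x') + ε • star (e.theta y' y) +
        ε • (star (t.a w' (e.gammaT x)) - e.muT x w') + -z.mu y w' := rfl

theorem sig_solve (z : Preformation Λ ε) (t : z.FlipIso) (e : z.Extension)
    (p : InvDual Λ (InvDual Λ z.G)) (q : InvDual Λ z.G) (r : InvDual Λ z.F) :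
    ∃ (x : InvDual Λ z.G) (y : z.G) (w : z.F),
      (∀ x', e.muT x (e.gammaT x') + e.muT x (e.gammaT x') +
        QGroup.symm t.nu (adj (t.a : z.F →ₗ[Λ] InvDual Λ z.F) (e.gammaT x))
          (adj (t.a : z.F →ₗ[Λ] InvDual Λ z.F) (e.gammaT x')) -
        t.a (z.gamma y) (e.gammaT x') + star (e.muT x' w) - t.a w (e.gammaT x') = p x') ∧
      (∀ y', ε • star (t.a (z.gamma y') (e.gammaT x)) - z.mu y (z.gamma y') +
        ε • star (z.mu y' w) = q y') ∧
      (∀ w', ε • (star (t.a w' (e.gammaT x)) - e.muT x w') - z.mu y w' = r w') := by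
  obtain ⟨E, hE⟩ : ∃ E : z.G ≃ₗ[Λ] InvDual Λ (InvDual Λ z.G), ∀ g x, E g x = star (x g) :=
    ⟨LinearEquiv.ofBijective (ev Λ z.G) ev_bijective, fun _ _ => rfl⟩
  obtain ⟨A, hA⟩ : ∃ A : z.F →ₗ[Λ] InvDual Λ z.F, A = t.a := ⟨_, rfl⟩
  have hAt : Function.Bijective (adj A) := by
    refine Function.Bijective.comp (g := dualMap A) ?_ ev_bijective
    refine Function.bijective_iff_has_inverse.2
      ⟨dualMap (t.a.symm : InvDual Λ z.F →ₗ[Λ] z.F), fun f => ?_, fun f => ?_⟩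
    · ext u; simp [hA]
    · ext u; simp [hA]
  obtain ⟨At, hAt2⟩ : ∃ At : z.F ≃ₗ[Λ] InvDual Λ z.F, ∀ u, At u = adj A u :=
    ⟨LinearEquiv.ofBijective (adj A) hAt, fun _ => rfl⟩
  obtain ⟨gts, hEg⟩ : ∃ gts : InvDual Λ z.F →ₗ[Λ] z.G, ∀ v, E (gts v) = dualMap e.gammaT v :=
    ⟨E.symm ∘ₗ dualMap e.gammaT, fun v => E.apply_symm_apply _⟩
  obtain ⟨mts, hEm⟩ : ∃ mts : z.F →ₗ[Λ] z.G, ∀ u, E (mts u) = adj e.muT u :=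
    ⟨E.symm ∘ₗ adj e.muT, fun v => E.apply_symm_apply _⟩
  have h2 : ∀ g, adj z.mu (z.gamma g) = -(ε • dualMap z.gamma (z.mu g)) := by
    intro g
    ext y
    have h := z.mu_gamma g y
    simp only [adj_apply, InvDual.neg_apply, InvDual.units_smul_apply, dualMap_apply, h]
    rcases Int.units_eq_one_or ε with rfl | rfl <;> simp
  have h3 : ∀ x, mts (e.gammaT x) = -(ε • gts (e.muT x)) := by
    intro x
    apply E.injective
    rw [map_neg, Units.smul_def, map_zsmul, ← Units.smul_def, hEm, hEg, e.eq3]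
  have h4 : ∀ g, mts (z.gamma g) + ε • gts (z.mu g) = g := by
    intro g
    apply E.injective
    rw [map_add, Units.smul_def, map_zsmul, ← Units.smul_def, hEm, hEg]
    ext x
    have h := DFunLike.congr_fun (e.eq1 x) g
    rw [hE, ← h]
    simp only [InvDual.add_apply, dualMap_apply, InvDual.units_smul_apply, adj_apply, star_add]
    rcases Int.units_eq_one_or ε with rfl | rfl <;> simp
  have hf : ∀ u, ∃ g x, z.gamma g + e.gammaT x = u ∧ z.mu g + e.muT x = 0 := by
    intro u
    obtain ⟨⟨g, x⟩, h⟩ := e.bijective.2 (u, 0)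
    exact ⟨g, x, congrArg Prod.fst h, congrArg Prod.snd h⟩
  have h7 : ∀ g, A (z.gamma g) = ε • (dualMap (adj A) ∘ₗ QGroup.symm t.nu) (z.mu g) +
      ε • z.mu (t.b g) := by
    intro g
    rw [hA]
    exact t.gamma_eq g
  have h8 : ∀ g, At (z.gamma (t.b g)) = z.mu g := by
    intro g
    rw [hAt2, hA]
    exact t.mu_eq g
  obtain ⟨x, y, w, k1, k2, k3⟩ := signature_solve ε z.gamma.toAddMonoidHom z.mu.toAddMonoidHom
    e.gammaT.toAddMonoidHom e.muT.toAddMonoidHom (dualMap z.gamma).toAddMonoidHom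
    (adj z.mu).toAddMonoidHom gts.toAddMonoidHom mts.toAddMonoidHom A.toAddMonoidHom
    At.toAddEquiv (dualMap (adj A) ∘ₗ QGroup.symm t.nu).toAddMonoidHom t.b.toAddEquiv
    e.eq1 h2 h3 h4 hf h7 h8 (E.symm p) q r
  change gts (e.muT x) + gts (e.muT x) +
    gts ((dualMap (adj A) ∘ₗ QGroup.symm t.nu) (At (e.gammaT x))) - gts (A (z.gamma y)) +
    mts w - gts (A w) = E.symm p at k1
  change ε • dualMap z.gamma (At (e.gammaT x)) - dualMap z.gamma (z.mu y) + ε • adj z.mu w = q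
    at k2
  change ε • (At (e.gammaT x) - e.muT x) - z.mu y = r at k3
  rw [hAt2] at k1 k2 k3
  refine ⟨x, y, w, fun x' => ?_, fun y' => ?_, fun w' => ?_⟩
  · have h := congrArg (fun g => E g x') k1
    simp only [map_add, map_sub, hEg, hEm, LinearEquiv.apply_symm_apply] at h
    rw [hA] at h
    exact h
  · have h := DFunLike.congr_fun k2 y'
    rw [hA] at h
    simpa using h
  · have h := DFunLike.congr_fun k3 w'
    rw [hA] at h
    simpa using h

theorem sigMap_surjective (z : Preformation Λ ε) (t : z.FlipIso) (e : z.Extension)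
    (ν : InvDual Λ z.F →ₗ[Λ] InvDual Λ (InvDual Λ z.F)) (hν : QGroup.mk (-ε) ν = t.nu) :
    Function.Surjective (QGroup.symm (QGroup.mk (-ε) (sigMap z t e ν))) := by
  intro φ
  obtain ⟨x, y, w, k1, k2, k3⟩ := sig_solve z t e (dualMap (LinearMap.inl Λ _ _) φ)
    (dualMap (LinearMap.inr Λ _ _ ∘ₗ LinearMap.inl Λ _ _) φ)
    (dualMap (LinearMap.inr Λ _ _ ∘ₗ LinearMap.inr Λ _ _) φ)
  refine ⟨(x, y, w), ?_⟩
  ext ⟨x', y', w'⟩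
  have hφ : φ (x', y', w') = φ (x', 0) + φ (0, y', 0) + φ (0, 0, w') := by
    rw [← map_add, ← map_add]
    simp
  have j1 := k1 x'
  have j2 := k2 y'
  have j3 := k3 w'
  have hθ : z.mu y (z.gamma y') = e.theta y y' - ε • star (e.theta y' y) := by
    have h := DFunLike.congr_fun (DFunLike.congr_fun z.compat y) y'
    rw [← e.theta_mk] at h
    simp only [QGroup.symm_mk_apply, Units.neg_smul, LinearMap.comp_apply, dualMap_apply] at h
    rw [← h, sub_eq_add_neg]
  have h33 := DFunLike.congr_fun (e.eq3 x) x'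
  simp only [adj_apply, InvDual.neg_apply, InvDual.units_smul_apply, dualMap_apply] at h33
  simp only [dualMap_apply, LinearMap.comp_apply, LinearMap.inl_apply, LinearMap.inr_apply]
    at j1 j2 j3
  rw [hφ, ← j1, ← j2, ← j3, hθ, QGroup.symm_mk_apply, sigMap_apply, sigMap_apply, ← hν,
    QGroup.symm_mk_apply]
  simp only [star_add, star_neg, Units.neg_smul]
  rcases Int.units_eq_one_or ε with rfl | rfl <;>
    simp only [one_smul, Units.neg_smul, star_neg, star_sub, star_star, neg_neg, h33] <;> abel

theorem sigMap_bijective (z : Preformation Λ ε) (t : z.FlipIso) (e : z.Extension)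
    (ν : InvDual Λ z.F →ₗ[Λ] InvDual Λ (InvDual Λ z.F)) (hν : QGroup.mk (-ε) ν = t.nu) :
    Function.Bijective (QGroup.symm (QGroup.mk (-ε) (sigMap z t e ν))) :=
  ⟨QGroup.injective_of_surjective _ (sigMap_surjective z t e ν hν),
    sigMap_surjective z t e ν hν⟩

/-- The quadratic signature: the class in `L_{2q+2}(Λ)` (where `ε = (-1)^q`) of the non-singular
`(-ε)`-quadratic form `(M, ξ)`. -/
def quadraticSignature (z : Preformation Λ ε) (t : z.FlipIso) (e : z.Extension)
    (ν : InvDual Λ z.F →ₗ[Λ] InvDual Λ (InvDual Λ z.F)) (hν : QGroup.mk (-ε) ν = t.nu) :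
    LGroup Λ (-ε) :=
  Quotient.mk _
    { M := z.SigModule
      psi := QGroup.mk (-ε) (sigMap z t e ν)
      nonsing := sigMap_bijective z t e ν hν }

end Preformation

end Preformations

end SurgeryL

namespace SurgeryL

/-! ### Duality, stable finiteness and classes in `QGroup` -/

section

variable {Λ : Type*} [Ring Λ]
variable {M N K : Type*} [AddCommGroup M] [Module Λ M] [AddCommGroup N] [Module Λ N]
  [AddCommGroup K] [Module Λ K]

/-! An h-lagrangian U of z splits F as U ⊕ U*, where U is embedded by γ and U* is paired with U by
μ. In these coordinates minus the symmetrized hyperbolic form is an isomorphism α : F → F*, and a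
reflection β of G along U makes (α, β, 0) a flip-isomorphism (`HSplitting.flipIso`). For a
stabilization of a non-singular formation, the lagrangian G of H(F) has a complement which can be
corrected to an isotropic one, so an extension exists (`DualSplitting.exists_extension`). The
signature form on M = G* ⊕ G ⊕ F then vanishes on the vectors (x, j u, ε γt x + γ j v) with x zero
on jU. They form a split submodule of half the rank of M, so the form is hyperbolic.

Conversely, a stabilization of z carries the signature form with reversed sign. Send (x, y, w) in M
to y in G, to (x, w) in G* ⊕ F, and to minus the G* ⊕ F-components of ξ in the dual of G* ⊕ F. In
the quadratic form of z ⊕ ∂H(G* ⊕ F) every entry of ξ cancels except ε θ*, which θ absorbs. The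
flip-isomorphism and the inverse of the extended isometry provide a copy of F* that is isotropic and
orthogonal to M, and M ⊕ F* stays split injective after γ and after μ. If ξ is Witt-trivial, then M
⊕ H(P) contains a split isotropic Q of half rank, and Q ⊕ F* becomes an h-lagrangian once ∂H(P) is
added (`exists_isElementary_sum_of_embedding`).

Weak finiteness enters through `comp_eq_id_of_equiv`: one-sided inverses between free modules of
equal rank are two-sided. This is what makes half rank sufficient, both for a form to be hyperbolic
(`NSForm.isometric_hyp_of_isotropic`) and for a submodule to be an h-lagrangian
(`isElementary_of_split`). -/

theorem star_units_smul [StarRing Λ] (ε : ℤˣ) (a : Λ) : star (ε • a) = ε • star a := by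
  rcases Int.units_eq_one_or ε with rfl | rfl <;> simp

/-- Over a stably finite ring a left inverse between isomorphic finitely generated free modules is
a right inverse. -/
theorem comp_eq_id_of_equiv [IsStablyFiniteRing Λ] [Module.Free Λ M] [Module.Finite Λ M]
    (e : M ≃ₗ[Λ] N) {f : M →ₗ[Λ] N} {g : N →ₗ[Λ] M} (h : g ∘ₗ f = LinearMap.id) :
    f ∘ₗ g = LinearMap.id := by
  have h1 : (g ∘ₗ (e : M →ₗ[Λ] N)) ∘ₗ ((e.symm : N →ₗ[Λ] M) ∘ₗ f) = LinearMap.id := by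
    ext x
    simpa using DFunLike.congr_fun h x
  rw [LinearMap.comp_eq_id_comm] at h1
  ext y
  have h2 := DFunLike.congr_fun h1 (e.symm y)
  simp only [LinearMap.comp_apply, LinearEquiv.coe_coe, LinearEquiv.apply_symm_apply,
    LinearMap.id_apply] at h2
  exact e.symm.injective h2

variable [StarRing Λ]

variable (Λ M) in
/-- A finitely generated free module is its double dual. -/
noncomputable def evEquiv [Module.Free Λ M] [Module.Finite Λ M] :
    M ≃ₗ[Λ] InvDual Λ (InvDual Λ M) :=
  LinearEquiv.ofBijective (ev Λ M) ev_bijective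

@[simp] theorem evEquiv_apply [Module.Free Λ M] [Module.Finite Λ M] (x : M) (f : InvDual Λ M) :
    evEquiv Λ M x f = star (f x) := rfl

@[simp] theorem apply_evEquiv_symm [Module.Free Λ M] [Module.Finite Λ M]
    (Φ : InvDual Λ (InvDual Λ M)) (f : InvDual Λ M) : f ((evEquiv Λ M).symm Φ) = star (Φ f) := by
  have h := DFunLike.congr_fun ((evEquiv Λ M).apply_symm_apply Φ) f
  rw [evEquiv_apply] at h
  rw [← h, star_star]

theorem eq_of_forall_dual [Module.Free Λ M] [Module.Finite Λ M] {x y : M}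
    (h : ∀ f : InvDual Λ M, f x = f y) : x = y :=
  (evEquiv Λ M).injective (InvDual.ext fun f => by simp [h f])

variable (Λ M N) in
/-- The dual of a direct sum. -/
def dualProd : InvDual Λ (M × N) ≃ₗ[Λ] InvDual Λ M × InvDual Λ N where
  __ := (dualMap (LinearMap.inl Λ M N)).prod (dualMap (LinearMap.inr Λ M N))
  invFun f := dualMap (LinearMap.fst Λ M N) f.1 + dualMap (LinearMap.snd Λ M N) f.2
  left_inv f := by
    ext ⟨x, y⟩
    simp [← map_add]
  right_inv f := by
    refine Prod.ext ?_ ?_ <;> ext x <;> simp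

/-- A finitely generated free module is isomorphic to its dual, non-canonically. -/
theorem exists_equiv_dual [Module.Free Λ M] [Module.Finite Λ M] :
    Nonempty (M ≃ₗ[Λ] InvDual Λ M) :=
  ⟨(Module.Free.chooseBasis Λ M).equivFun.trans (dualCoord (Module.Free.chooseBasis Λ M))⟩

namespace QGroup

variable {ε : ℤˣ}

theorem mk_eq_zero_iff {φ : M →ₗ[Λ] InvDual Λ M} :
    mk ε φ = 0 ↔ ∃ χ : M →ₗ[Λ] InvDual Λ M, ∀ x y, φ x y = χ x y - ε • star (χ y x) := by
  rw [mk, QuotientAddGroup.eq_zero_iff]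
  constructor
  · rintro ⟨χ, rfl⟩
    exact ⟨χ, fun x y => rfl⟩
  · rintro ⟨χ, h⟩
    exact ⟨χ, LinearMap.ext fun x => InvDual.ext fun y => (h x y).symm⟩

theorem mk_neg (φ : M →ₗ[Λ] InvDual Λ M) : mk ε (-φ) = -mk ε φ := rfl

theorem mk_sub (φ ψ : M →ₗ[Λ] InvDual Λ M) : mk ε (φ - ψ) = mk ε φ - mk ε ψ := rfl

theorem mk_zero : mk ε (0 : M →ₗ[Λ] InvDual Λ M) = 0 := rfl

theorem exists_rep (θ : QGroup Λ M ε) : ∃ φ, mk ε φ = θ := by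
  induction θ using ind with | h φ => exact ⟨φ, rfl⟩

theorem mk_eq_zero_of_apply {φ : M →ₗ[Λ] InvDual Λ M} (χ : M →ₗ[Λ] InvDual Λ M)
    (h : ∀ x y, φ x y = χ x y - ε • star (χ y x)) : mk ε φ = 0 :=
  mk_eq_zero_iff.2 ⟨χ, h⟩

theorem mk_units_smul_adj (φ : M →ₗ[Λ] InvDual Λ M) : mk ε (ε • adj φ) = mk ε φ := by
  rw [← sub_eq_zero, ← mk_sub]
  refine mk_eq_zero_of_apply (-φ) fun x y => ?_
  simp only [LinearMap.sub_apply, InvDual.sub_apply, LinearMap.smul_apply,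
    InvDual.units_smul_apply, adj_apply, LinearMap.neg_apply, InvDual.neg_apply, star_neg, smul_neg]
  abel

theorem mk_symm (θ : QGroup Λ M ε) : mk ε (symm θ) = θ + θ := by
  induction θ using ind with
  | h φ =>
    rw [symm_mk, mk_add]
    congr 1
    exact mk_units_smul_adj φ

/-- Of the two cross terms g*φf and f*φg, the second may be replaced modulo 1 - T by its dual;
together they then form g*(1 + T)φ f. -/
theorem map_add_map (f g : M →ₗ[Λ] N) (θ : QGroup Λ N ε) :
    map (f + g) θ = map f θ + map g θ + mk ε (dualMap g ∘ₗ symm θ ∘ₗ f) := by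
  induction θ using ind with
  | h φ =>
    simp only [map_mk, ← mk_add]
    rw [← sub_eq_zero, ← mk_sub]
    refine mk_eq_zero_of_apply (dualMap f ∘ₗ φ ∘ₗ g) fun x y => ?_
    simp only [LinearMap.sub_apply, InvDual.sub_apply, LinearMap.add_apply, InvDual.add_apply,
      pull_apply, LinearMap.comp_apply, dualMap_apply, symm_mk_apply, map_add]
    abel

theorem map_neg_map (f : M →ₗ[Λ] N) (θ : QGroup Λ N ε) : map (-f) θ = map f θ := by
  induction θ using ind with
  | h φ =>
    simp only [map_mk]
    congr 1
    ext x y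
    simp

theorem map_sub_map (f g : M →ₗ[Λ] N) (θ : QGroup Λ N ε) :
    map (f - g) θ = map f θ + map g θ - mk ε (dualMap g ∘ₗ symm θ ∘ₗ f) := by
  have h : dualMap (-g) ∘ₗ symm θ ∘ₗ f = -(dualMap g ∘ₗ symm θ ∘ₗ f) := by
    ext x y
    simp
  rw [sub_eq_add_neg f g, map_add_map, map_neg_map, h, mk_neg]
  exact (sub_eq_add_neg _ _).symm

theorem symm_neg_smul (θ : QGroup Λ M (-ε)) (x y : M) :
    symm θ x y = -(ε • star (symm θ y x)) := by
  rw [symm_symm, Units.neg_smul]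

end QGroup

end

/-! ### Split submodules of half rank -/

section

variable {Λ : Type u} [Ring Λ] [StarRing Λ] {ε : ℤˣ}

/-- A nonsingular form with a split isotropic submodule of half rank is hyperbolic. -/
theorem NSForm.isometric_hyp_of_isotropic [IsStablyFiniteRing Λ] (A : NSForm Λ ε) (L : FreeMod Λ)
    (i : L.carrier →ₗ[Λ] A.M) (p : A.M →ₗ[Λ] L.carrier) (hp : p ∘ₗ i = LinearMap.id)
    (hi : QGroup.map i A.psi = 0) (e : (L.carrier × InvDual Λ L.carrier) ≃ₗ[Λ] A.M) :
    Isometric A (hyp ε L) := by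
  obtain ⟨S, hS⟩ : ∃ S : A.M ≃ₗ[Λ] InvDual Λ A.M, ∀ x y, S x y = QGroup.symm A.psi x y :=
    ⟨LinearEquiv.ofBijective _ A.nonsing, fun _ _ => rfl⟩
  have hii : ∀ l l', QGroup.symm A.psi (i l) (i l') = 0 := by
    intro l l'
    have := QGroup.symm_map i A.psi
    rw [hi, map_zero] at this
    exact (DFunLike.congr_fun (DFunLike.congr_fun this l) l').symm
  have hpi : ∀ l, p (i l) = l := fun l => DFunLike.congr_fun hp l
  let s : InvDual Λ L.carrier →ₗ[Λ] A.M := S.symm ∘ₗ dualMap p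
  have hs : ∀ φ l, QGroup.symm A.psi (s φ) (i l) = φ l := by
    intro φ l
    rw [← hS]
    simp [s, hpi]
  -- The map s is dual to i but need not be isotropic. Moving it along i by τ, the adjoint of ε κ,
  -- changes its form by the class of -ε κ*, which is that of -κ.
  obtain ⟨κ, hκ⟩ := QGroup.exists_rep (QGroup.map s A.psi)
  let τ : InvDual Λ L.carrier →ₗ[Λ] L.carrier := (evEquiv Λ L.carrier).symm ∘ₗ (ε • κ)
  have hτ : ∀ φ φ' : InvDual Λ L.carrier, φ (τ φ') = star (ε • κ φ' φ) := by
    intro φ φ'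
    simp only [τ, LinearMap.comp_apply, LinearEquiv.coe_coe, apply_evEquiv_symm]
    rfl
  let s' := s - i ∘ₗ τ
  have hs' : ∀ φ l, QGroup.symm A.psi (s' φ) (i l) = φ l := by
    intro φ l
    simp [s', hs, hii]
  let f : L.carrier × InvDual Λ L.carrier →ₗ[Λ] A.M := i.coprod s'
  have hq : QGroup.map s' A.psi = 0 := by
    have h : dualMap (i ∘ₗ τ) ∘ₗ QGroup.symm A.psi ∘ₗ s = ε • adj κ := by
      ext φ φ'
      change QGroup.symm A.psi (s φ) (i (τ φ')) = ε • star (κ φ' φ)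
      rw [hs, hτ, star_units_smul]
    rw [QGroup.map_sub_map, ← QGroup.map_map τ i, hi, map_zero, add_zero, h, ← hκ,
      QGroup.mk_units_smul_adj, sub_self]
  let f : L.carrier × InvDual Λ L.carrier →ₗ[Λ] A.M :=
    i ∘ₗ LinearMap.fst Λ _ _ + s' ∘ₗ LinearMap.snd Λ _ _
  have hf : QGroup.map f A.psi = QGroup.mk ε (hypMap Λ L.carrier) := by
    have h : dualMap (s' ∘ₗ LinearMap.snd Λ L.carrier (InvDual Λ L.carrier)) ∘ₗ
        QGroup.symm A.psi ∘ₗ i ∘ₗ LinearMap.fst Λ L.carrier (InvDual Λ L.carrier) =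
        ε • adj (hypMap Λ L.carrier) := by
      refine LinearMap.ext fun x => InvDual.ext fun y => ?_
      change QGroup.symm A.psi (i x.1) (s' y.2) = ε • star (y.2 x.1)
      rw [QGroup.symm_symm, hs']
    rw [QGroup.map_add_map, ← QGroup.map_map _ i, ← QGroup.map_map _ s', hi, hq, map_zero,
      map_zero, zero_add, zero_add, h, QGroup.mk_units_smul_adj]
  let φ : A.M →ₗ[Λ] InvDual Λ L.carrier := dualMap i ∘ₗ QGroup.symm A.psi
  -- On the image of f, φ reads off the L*-coordinate; removing that part leaves an element of i(L),
  -- which p inverts. This makes g only a left inverse; the rank hypothesis e makes it two-sided.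
  let g : A.M →ₗ[Λ] L.carrier × InvDual Λ L.carrier := (p ∘ₗ (LinearMap.id - s' ∘ₗ φ)).prod φ
  have hφ : ∀ x, φ (f x) = x.2 := by
    intro x
    ext l
    change QGroup.symm A.psi (i x.1 + s' x.2) (i l) = x.2 l
    rw [map_add, InvDual.add_apply, hii, hs', zero_add]
  have hgf : g ∘ₗ f = LinearMap.id := by
    refine LinearMap.ext fun x => Prod.ext ?_ (hφ x)
    change p (f x - s' (φ (f x))) = x.1
    rw [hφ]
    simp [f, hpi]
  have hfg := comp_eq_id_of_equiv e hgf
  exact Isometric.symm ⟨LinearEquiv.ofLinearMap f g hfg hgf, hf⟩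

namespace Preformation

/-- A split submodule of half rank on which the quadratic refinement vanishes is an
`h`-lagrangian. -/
theorem isElementary_of_split [IsStablyFiniteRing Λ] (z : Preformation Λ ε) (U : FreeMod Λ)
    (T : U.carrier →ₗ[Λ] z.G) (hT : QGroup.map T z.theta = 0)
    (ρ : z.F →ₗ[Λ] U.carrier) (hρ : ∀ u, ρ (z.gamma (T u)) = u)
    (ρ' : InvDual Λ z.F →ₗ[Λ] U.carrier) (hρ' : ∀ u, ρ' (z.mu (T u)) = u)
    (e : (U.carrier × InvDual Λ U.carrier) ≃ₗ[Λ] z.F) : z.IsElementary := by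
  have hz : ∀ u u', z.mu (T u) (z.gamma (T u')) = 0 := by
    intro u u'
    have := QGroup.symm_map T z.theta
    rw [hT, map_zero, z.compat] at this
    exact (DFunLike.congr_fun (DFunLike.congr_fun this u) u').symm
  have hTi : Function.Injective T := fun u v h => by rw [← hρ u, h, hρ]
  let E : U.carrier ≃ₗ[Λ] LinearMap.range T := LinearEquiv.ofInjective T hTi
  have hE : ∀ x : LinearMap.range T, ∃ u, (x : z.G) = T u := fun ⟨_, u, h⟩ => ⟨u, h.symm⟩
  have compl : ∀ {W : Type u} [AddCommGroup W] [Module Λ W] (f : z.G →ₗ[Λ] W)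
      (r : W →ₗ[Λ] U.carrier), (∀ u, r (f (T u)) = u) →
      IsCompl ((LinearMap.range T).map f) (LinearMap.ker r) := by
    intro W _ _ f r h
    constructor
    · rw [Submodule.disjoint_def]
      rintro _ ⟨_, ⟨u, rfl⟩, rfl⟩ hx
      rw [LinearMap.mem_ker, h] at hx
      simp [hx]
    · rw [codisjoint_iff, eq_top_iff]
      intro x _
      rw [Submodule.mem_sup]
      exact ⟨f (T (r x)), ⟨_, ⟨_, rfl⟩, rfl⟩, x - f (T (r x)), by simp [h], by abel⟩
  -- F* should be μ(TU) ⊕ ρ*(U*), with the second summand restricting isomorphically to the dual of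
  -- γ(TU). The projection ρ' gives a left inverse of f. Surjectivity, a matter of rank, shows that
  -- a functional vanishing on γ(TU) lies in μ(TU).
  let f : U.carrier × InvDual Λ U.carrier →ₗ[Λ] InvDual Λ z.F :=
    (z.mu ∘ₗ T).coprod (dualMap ρ)
  let c : InvDual Λ z.F →ₗ[Λ] InvDual Λ U.carrier := dualMap (z.gamma ∘ₗ T)
  let g : InvDual Λ z.F →ₗ[Λ] U.carrier × InvDual Λ U.carrier :=
    (ρ' ∘ₗ (LinearMap.id - dualMap ρ ∘ₗ c)).prod c
  have hc : ∀ x, c (f x) = x.2 := by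
    intro x
    ext u
    simp [c, f, hz, hρ]
  have hgf : g ∘ₗ f = LinearMap.id := by
    refine LinearMap.ext fun x => Prod.ext ?_ (hc x)
    change ρ' (f x - dualMap ρ (c (f x))) = x.1
    rw [hc]
    simp [f, hρ']
  obtain ⟨d⟩ := exists_equiv_dual (Λ := Λ) (M := z.F)
  have hfg := comp_eq_id_of_equiv (e.trans d) hgf
  have hker : ∀ v, c v = 0 → ∃ u, v = z.mu (T u) := by
    intro v hv
    have h := DFunLike.congr_fun hfg v
    refine ⟨(g v).1, ?_⟩
    change z.mu (T (g v).1) + dualMap ρ (c v) = v at h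
    rw [hv, map_zero, add_zero] at h
    exact h.symm
  have hle : (LinearMap.range T).map z.mu ≤
      LinearMap.ker (dualMap ((LinearMap.range T).map z.gamma).subtype) := by
    rintro _ ⟨_, ⟨u, rfl⟩, rfl⟩
    rw [LinearMap.mem_ker]
    ext ⟨_, _, ⟨u', rfl⟩, rfl⟩
    exact hz u u'
  refine ⟨LinearMap.range T, Module.Free.of_equiv E, Module.Finite.equiv E, ?_, ?_, ?_, ?_,
    ⟨_, compl z.gamma ρ hρ⟩, ⟨_, compl z.mu ρ' hρ'⟩, hle, ?_, ?_⟩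
  · ext x y
    obtain ⟨u, hu⟩ := hE x
    obtain ⟨u', hu'⟩ := hE y
    change z.mu (x : z.G) (z.gamma (y : z.G)) = 0
    rw [hu, hu', hz]
  · have h : (LinearMap.range T).subtype = T ∘ₗ (E.symm : LinearMap.range T →ₗ[Λ] U.carrier) := by
      ext x
      obtain ⟨u, rfl⟩ := E.surjective x
      simp [E]
    rw [h, ← QGroup.map_map, hT, map_zero]
  · intro x y h
    obtain ⟨u, hu⟩ := hE x
    obtain ⟨u', hu'⟩ := hE y
    have h2 : z.gamma (x : z.G) = z.gamma (y : z.G) := h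
    rw [hu, hu'] at h2
    apply Subtype.ext
    rw [hu, hu', ← hρ u, h2, hρ]
  · intro x y h
    obtain ⟨u, hu⟩ := hE x
    obtain ⟨u', hu'⟩ := hE y
    have h2 : z.mu (x : z.G) = z.mu (y : z.G) := h
    rw [hu, hu'] at h2
    apply Subtype.ext
    rw [hu, hu', ← hρ' u, h2, hρ']
  · rw [injective_iff_map_eq_zero]
    intro x hx
    obtain ⟨v, rfl⟩ := Submodule.mkQ_surjective _ x
    rw [Submodule.mkQ_apply, Submodule.liftQ_apply] at hx
    obtain ⟨u, rfl⟩ := hker v (InvDual.ext fun u =>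
      DFunLike.congr_fun hx ⟨z.gamma (T u), _, ⟨u, rfl⟩, rfl⟩)
    rw [Submodule.mkQ_apply, Submodule.Quotient.mk_eq_zero]
    exact ⟨_, ⟨u, rfl⟩, rfl⟩
  · intro φ
    let k : U.carrier →ₗ[Λ] (LinearMap.range T).map z.gamma :=
      (z.gamma ∘ₗ T).codRestrict _ fun u => ⟨_, ⟨u, rfl⟩, rfl⟩
    refine ⟨Submodule.Quotient.mk (dualMap (k ∘ₗ ρ) φ), ?_⟩
    rw [Submodule.liftQ_apply]
    ext ⟨_, _, ⟨u, rfl⟩, rfl⟩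
    change φ (k (ρ (z.gamma (T u)))) = _
    rw [hρ]
    rfl

end Preformation

end
-- Strong isomorphisms and stabilization
theorem QGroup.map_prodMap_sum {Λ : Type*} [Ring Λ] [StarRing Λ] {ε : ℤˣ} {M N M' N' : Type*}
    [AddCommGroup M] [Module Λ M] [AddCommGroup N] [Module Λ N] [AddCommGroup M'] [Module Λ M']
    [AddCommGroup N'] [Module Λ N'] (f : M →ₗ[Λ] M') (g : N →ₗ[Λ] N') (x : QGroup Λ M' ε)
    (y : QGroup Λ N' ε) :
    QGroup.map (f.prodMap g) (QGroup.sum x y) = QGroup.sum (QGroup.map f x) (QGroup.map g y) := by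
  simp only [QGroup.sum, map_add, QGroup.map_map]
  rfl

namespace Preformation

variable {Λ : Type u} [Ring Λ] [StarRing Λ] {ε : ℤˣ}

theorem boundaryHyp_mu_apply (P : FreeMod Λ) (g f : P.carrier × InvDual Λ P.carrier) :
    (boundaryHyp ε P).mu g f = g.2 f.1 - ε • star (f.2 g.1) := by
  rw [sub_eq_add_neg, ← Units.neg_smul]
  rfl

namespace StrongIso

/-- A strong isomorphism from an elementwise description of its compatibility with `μ`. -/
def ofApply {z z' : Preformation Λ ε} (α : z.F ≃ₗ[Λ] z'.F) (β : z.G ≃ₗ[Λ] z'.G)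
    (hγ : ∀ g, α (z.gamma g) = z'.gamma (β g)) (hμ : ∀ g f, z'.mu (β g) (α f) = z.mu g f)
    (hθ : z.theta = QGroup.map (β : z.G →ₗ[Λ] z'.G) z'.theta) : StrongIso z z' where
  alpha := α
  beta := β
  gamma_comm := LinearMap.ext hγ
  mu_comm := LinearMap.ext fun g => InvDual.ext fun f => by
    have h := hμ g (α.symm f)
    rw [LinearEquiv.apply_symm_apply] at h
    exact h.symm
  theta_comm := hθ

theorem gamma_apply {z z' : Preformation Λ ε} (s : StrongIso z z') (g : z.G) :
    s.alpha (z.gamma g) = z'.gamma (s.beta g) :=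
  DFunLike.congr_fun s.gamma_comm g

theorem mu_apply {z z' : Preformation Λ ε} (s : StrongIso z z') (g : z.G) (f : z.F) :
    z'.mu (s.beta g) (s.alpha f) = z.mu g f := by
  have h := DFunLike.congr_fun (DFunLike.congr_fun s.mu_comm g) (s.alpha f)
  change z.mu g (s.alpha.symm (s.alpha f)) = _ at h
  rw [LinearEquiv.symm_apply_apply] at h
  exact h.symm

/-- Composition of strong isomorphisms. -/
def trans {z z' z'' : Preformation Λ ε} (s : StrongIso z z') (t : StrongIso z' z'') :
    StrongIso z z'' :=
  ofApply (s.alpha.trans t.alpha) (s.beta.trans t.beta)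
    (fun g => by simp [s.gamma_apply, t.gamma_apply])
    (fun g f => by simp [s.mu_apply, t.mu_apply])
    (by rw [s.theta_comm, t.theta_comm, QGroup.map_map]; rfl)

/-- The sum of a strong isomorphism and an identity. -/
def sumRight {z z' : Preformation Λ ε} (s : StrongIso z z') (y : Preformation Λ ε) :
    StrongIso (z.sum y) (z'.sum y) :=
  ofApply (LinearEquiv.prodCongr s.alpha (LinearEquiv.refl Λ y.F))
    (LinearEquiv.prodCongr s.beta (LinearEquiv.refl Λ y.G))
    (fun g => Prod.ext (s.gamma_apply g.1) rfl)
    (fun g f => congrArg (· + y.mu g.2 f.2) (s.mu_apply g.1 f.1))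
    ((congrArg (QGroup.sum · y.theta) s.theta_comm).trans
      (QGroup.map_sum_congr (s.beta : z.G →ₗ[Λ] z'.G) z'.theta y.theta).symm)

/-- `(x ⊕ y) ⊕ z = (x ⊕ z) ⊕ y`. -/
def sumSwap (x y z : Preformation Λ ε) : StrongIso ((x.sum y).sum z) ((x.sum z).sum y) :=
  ofApply (swapEquiv Λ x.F y.F z.F) (swapEquiv Λ x.G y.G z.G) (fun _ => rfl)
    (fun g f => add_right_comm (x.mu g.1.1 f.1.1) (z.mu g.2 f.2) (y.mu g.1.2 f.1.2))
    (QGroup.map_swap x.theta y.theta z.theta).symm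

/-- `(z ⊕ ∂H(P)) ⊕ ∂H(Q) = z ⊕ ∂H(P ⊕ Q)`. -/
def sumHyp (z : Preformation Λ ε) (P Q : FreeMod Λ) :
    StrongIso ((z.sum (boundaryHyp ε P)).sum (boundaryHyp ε Q))
      (z.sum (boundaryHyp ε (P.prod Q))) :=
  ofApply (hypSumEquiv Λ z.F P.carrier Q.carrier) (hypSumEquiv Λ z.G P.carrier Q.carrier)
    (fun _ => rfl)
    (fun ⟨⟨g, p⟩, q⟩ ⟨⟨f, p'⟩, q'⟩ => by
      refine (congrArg (z.mu g f + ·) (boundaryHyp_mu_apply (P.prod Q) _ _)).trans ?_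
      refine Eq.trans ?_ (congrArg₂ (fun a b => z.mu g f + a + b) (boundaryHyp_mu_apply P p p')
        (boundaryHyp_mu_apply Q q q')).symm
      change z.mu g f + ((p.2 p'.1 + q.2 q'.1) - ε • star (p'.2 p.1 + q'.2 q.1)) = _
      rw [star_add, smul_add]
      abel)
    (QGroup.map_hypSum z.theta).symm

end StrongIso

/-- Adding the boundary of a hyperbolic form does not change the stable class. -/
theorem StablyStronglyIso.sum_boundaryHyp {z z' : Preformation Λ ε} (h : StablyStronglyIso z z')
    (P : FreeMod Λ) : StablyStronglyIso (z.sum (boundaryHyp ε P)) z' := by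
  obtain ⟨Q, Q', ⟨s⟩⟩ := h
  exact ⟨Q, Q'.prod P, ⟨((StrongIso.sumSwap z (boundaryHyp ε P) (boundaryHyp ε Q)).trans
    (s.sumRight (boundaryHyp ε P))).trans (StrongIso.sumHyp z' Q' P)⟩⟩

theorem stablyStronglyIso_sum_boundaryHyp (z : Preformation Λ ε) (P : FreeMod Λ) :
    StablyStronglyIso (z.sum (boundaryHyp ε P)) z :=
  ⟨⟨PUnit⟩, P.prod ⟨PUnit⟩, ⟨StrongIso.sumHyp z P ⟨PUnit⟩⟩⟩

/-! ### Splittings coming from h-lagrangians -/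

/-- An `h`-lagrangian `j : U → G` together with a compatible splitting `F = U ⊕ U*`. -/
structure HSplitting (z : Preformation Λ ε) where
  U : FreeMod Λ
  j : U.carrier →ₗ[Λ] z.G
  rho : z.F →ₗ[Λ] U.carrier
  sigma : InvDual Λ U.carrier →ₗ[Λ] z.F
  rho_gamma : ∀ u, rho (z.gamma (j u)) = u
  mu_sigma : ∀ u χ, z.mu (j u) (sigma χ) = star (χ u)
  decomp : ∀ w, z.gamma (j (rho w)) + sigma (adj (z.mu ∘ₗ j) w) = w
  theta_zero : QGroup.map j z.theta = 0

/-- An `h`-lagrangian splits off. -/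
theorem IsElementary.exists_hSplitting {z : Preformation Λ ε} (h : z.IsElementary) :
    Nonempty (HSplitting z) := by
  obtain ⟨U, hU⟩ := h
  have := hU.free
  have := hU.finite
  obtain ⟨V, hV⟩ := hU.gamma_summand
  obtain ⟨hle, hbij⟩ := hU.restrict_bijective
  have hker : ∀ f : InvDual Λ z.F, (∀ u ∈ U, f (z.gamma u) = 0) → f ∈ U.map z.mu := by
    intro f hf
    rw [← Submodule.Quotient.mk_eq_zero]
    apply hbij.1
    rw [map_zero, Submodule.liftQ_apply]
    ext ⟨_, u, hu, rfl⟩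
    exact hf u hu
  have hzero : ∀ u ∈ U, ∀ u' ∈ U, z.mu u (z.gamma u') = 0 := by
    intro u hu u' hu'
    exact DFunLike.congr_fun (DFunLike.congr_fun hU.symm_zero ⟨u, hu⟩) ⟨u', hu'⟩
  let Eγ : U ≃ₗ[Λ] U.map z.gamma := LinearEquiv.ofBijective
    ((z.gamma ∘ₗ U.subtype).codRestrict (U.map z.gamma)
      fun u => Submodule.mem_map_of_mem u.2)
    ⟨fun u v h => hU.gamma_injOn (congrArg Subtype.val h), by
      rintro ⟨_, u, hu, rfl⟩
      exact ⟨⟨u, hu⟩, rfl⟩⟩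
  let Eμ : U ≃ₗ[Λ] U.map z.mu := LinearEquiv.ofBijective
    ((z.mu ∘ₗ U.subtype).codRestrict (U.map z.mu)
      fun u => Submodule.mem_map_of_mem u.2)
    ⟨fun u v h => hU.mu_injOn (congrArg Subtype.val h), by
      rintro ⟨_, u, hu, rfl⟩
      exact ⟨⟨u, hu⟩, rfl⟩⟩
  have hEμ : ∀ x : U.map z.mu, z.mu (Eμ.symm x : z.G) = x := fun x =>
    congrArg Subtype.val (Eμ.apply_symm_apply x)
  let ρ : z.F →ₗ[Λ] U := Eγ.symm ∘ₗ Submodule.projectionOnto _ _ hV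
  let pV : z.F →ₗ[Λ] z.F := LinearMap.id - z.gamma ∘ₗ U.subtype ∘ₗ ρ
  have hργ : ∀ u : U, ρ (z.gamma u) = u := by
    intro u
    change Eγ.symm (Submodule.projectionOnto _ _ hV (Eγ u : z.F)) = u
    rw [Submodule.projectionOnto_apply_left, LinearEquiv.symm_apply_apply]
  have hpγ : ∀ u : U, pV (z.gamma u) = 0 := by
    intro u
    simp [pV, hργ]
  have hpμ : ∀ (u : U) w, z.mu u (pV w) = z.mu u w := by
    intro u w
    simp [pV, hzero u u.2 (ρ w) (ρ w).2]
  -- As `pV` is the projection onto V along γ(U), the functional f ∘ `pV` annihilates γ(U), hence is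
  -- μ of a unique K f in U. The dual of K is the embedding σ of U*.
  let K : InvDual Λ z.F →ₗ[Λ] U := Eμ.symm ∘ₗ (dualMap pV).codRestrict _ fun f =>
    hker _ fun u hu => by
      rw [dualMap_apply, hpγ ⟨u, hu⟩, map_zero]
  have hK : ∀ f w, z.mu (K f) w = f (pV w) := fun f w =>
    DFunLike.congr_fun (hEμ _) w
  have hKμ : ∀ u : U, K (z.mu u) = u := by
    intro u
    apply hU.mu_injOn
    ext w
    exact (hK _ _).trans (hpμ u w)
  let σ : InvDual Λ U →ₗ[Λ] z.F := (evEquiv Λ z.F).symm ∘ₗ dualMap K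
  have hσ : ∀ (f : InvDual Λ z.F) χ, f (σ χ) = star (χ (K f)) := fun f χ =>
    apply_evEquiv_symm _ f
  refine ⟨⟨⟨U⟩, U.subtype, ρ, σ, hργ, fun u χ => ?_, fun w => ?_, hU.theta_zero⟩⟩
  · exact (hσ _ _).trans (by rw [Submodule.subtype_apply, hKμ])
  · have h : σ (adj (z.mu ∘ₗ U.subtype) w) = pV w := by
      refine eq_of_forall_dual (Λ := Λ) fun f => ?_
      rw [hσ, adj_apply, star_star]
      exact hK f w
    rw [h]
    simp [pV]

namespace HSplitting

/-- Transport of a splitting along a strong isomorphism. -/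
def transport {z z' : Preformation Λ ε} (H : HSplitting z) (s : StrongIso z z') :
    HSplitting z' where
  U := H.U
  j := s.beta ∘ₗ H.j
  rho := H.rho ∘ₗ (s.alpha.symm : z'.F →ₗ[Λ] z.F)
  sigma := s.alpha ∘ₗ H.sigma
  rho_gamma u := by
    have h := s.gamma_apply (H.j u)
    simp only [LinearMap.comp_apply, LinearEquiv.coe_coe] at h ⊢
    rw [← h, LinearEquiv.symm_apply_apply, H.rho_gamma]
  mu_sigma u χ := (s.mu_apply _ _).trans (H.mu_sigma u χ)
  decomp w := by
    obtain ⟨v, rfl⟩ := s.alpha.surjective w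
    have h1 : adj (z'.mu ∘ₗ (s.beta : z.G →ₗ[Λ] z'.G) ∘ₗ H.j) (s.alpha v) =
        adj (z.mu ∘ₗ H.j) v := by
      ext u
      exact congrArg star (s.mu_apply (H.j u) v)
    simp only [LinearMap.comp_apply, LinearEquiv.coe_coe, LinearEquiv.symm_apply_apply]
    rw [h1, ← s.gamma_apply, ← map_add, H.decomp]
  theta_zero := by
    rw [← QGroup.map_map, ← s.theta_comm, H.theta_zero]

/-- The sum of two splittings. -/
def sum {z y : Preformation Λ ε} (H : HSplitting z) (H' : HSplitting y) :
    HSplitting (z.sum y) where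
  U := H.U.prod H'.U
  j := H.j.prodMap H'.j
  rho := H.rho.prodMap H'.rho
  sigma := (H.sigma.prodMap H'.sigma) ∘ₗ
    (dualProd Λ H.U.carrier H'.U.carrier : InvDual Λ (H.U.carrier × H'.U.carrier) →ₗ[Λ] _)
  rho_gamma u := Prod.ext (H.rho_gamma u.1) (H'.rho_gamma u.2)
  mu_sigma := by
    rintro ⟨u, p⟩ χ
    let χ' : InvDual Λ (H.U.carrier × H'.U.carrier) := χ
    have h : χ' (u, p) = χ' (u, 0) + χ' (0, p) := by rw [← map_add]; simp
    refine (congrArg₂ (· + ·) (H.mu_sigma u _) (H'.mu_sigma p _)).trans ?_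
    exact ((congrArg star h).trans (star_add _ _)).symm
  decomp := by
    rintro ⟨w, w'⟩
    have h : dualProd Λ H.U.carrier H'.U.carrier
        (adj ((z.sum y).mu ∘ₗ H.j.prodMap H'.j) ((w, w') : z.F × y.F)) =
        (adj (z.mu ∘ₗ H.j) w, adj (y.mu ∘ₗ H'.j) w') := by
      refine Prod.ext (InvDual.ext fun u => ?_) (InvDual.ext fun u => ?_)
      · change star (z.mu (H.j u) w + y.mu (H'.j 0) w') = star (z.mu (H.j u) w)
        simp
      · change star (z.mu (H.j 0) w + y.mu (H'.j u) w') = star (y.mu (H'.j u) w')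
        simp
    refine (congrArg (fun x => (z.gamma (H.j (H.rho w)), y.gamma (H'.j (H'.rho w'))) +
      (H.sigma.prodMap H'.sigma) x) h).trans ?_
    exact Prod.ext (H.decomp w) (H'.decomp w')
  theta_zero := by
    refine (QGroup.map_prodMap_sum H.j H'.j z.theta y.theta).trans ?_
    rw [H.theta_zero, H'.theta_zero, QGroup.sum, map_zero, map_zero, add_zero]
    rfl

/-- The evident splitting of `∂H(P)`. -/
def boundaryHyp (ε : ℤˣ) (P : FreeMod Λ) : HSplitting (boundaryHyp ε P) where
  U := P
  j := LinearMap.inl Λ P.carrier (InvDual Λ P.carrier)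
  rho := LinearMap.fst Λ P.carrier (InvDual Λ P.carrier)
  -- The pairing of (p, 0) with (0, φ) under μ is -ε times the conjugate of φ(p); the sign -ε
  -- compensates.
  sigma := -(ε • LinearMap.inr Λ P.carrier (InvDual Λ P.carrier))
  rho_gamma _ := rfl
  mu_sigma p χ := by
    refine (boundaryHyp_mu_apply P _ _).trans ?_
    change (0 : InvDual Λ P.carrier) (-(ε • (0 : P.carrier))) - ε • star ((-(ε • χ)) p) = _
    rcases Int.units_eq_one_or ε with rfl | rfl <;> simp
  decomp := by
    rintro ⟨p, φ⟩
    have h : adj ((Preformation.boundaryHyp ε P).mu ∘ₗ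
        LinearMap.inl Λ P.carrier (InvDual Λ P.carrier)) ((p, φ) : P.carrier × _) = -(ε • φ) := by
      ext x
      refine (congrArg star (boundaryHyp_mu_apply P _ _)).trans ?_
      change star ((0 : InvDual Λ P.carrier) p - ε • star (φ x)) = -(ε • φ x)
      rcases Int.units_eq_one_or ε with rfl | rfl <;> simp
    refine (congrArg (fun x => ((p, 0) : P.carrier × InvDual Λ P.carrier) +
      (-(ε • ((0, x) : P.carrier × InvDual Λ P.carrier)))) h).trans ?_
    rcases Int.units_eq_one_or ε with rfl | rfl <;> simp
  theta_zero := by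
    refine QGroup.mk_eq_zero_of_apply 0 fun x y => ?_
    change (0 : InvDual Λ P.carrier) y = _
    simp

end HSplitting

/-! ### The flip-isomorphism of a splitting -/

namespace HSplitting

variable {z : Preformation Λ ε} (H : HSplitting z)

theorem mu_j_gamma_j (u u' : H.U.carrier) : z.mu (H.j u) (z.gamma (H.j u')) = 0 := by
  have := QGroup.symm_map H.j z.theta
  rw [H.theta_zero, map_zero, z.compat] at this
  exact (DFunLike.congr_fun (DFunLike.congr_fun this u) u').symm

theorem adj_sigma (χ : InvDual Λ H.U.carrier) : adj (z.mu ∘ₗ H.j) (H.sigma χ) = χ := by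
  ext u
  rw [adj_apply, LinearMap.comp_apply, H.mu_sigma, star_star]

/-- In the decomposition of σ χ the second term is already σ χ, so γ j ρ σ χ = 0, and ρ is a left
inverse of γ j. -/
theorem rho_sigma (χ : InvDual Λ H.U.carrier) : H.rho (H.sigma χ) = 0 := by
  have h := H.decomp (H.sigma χ)
  rw [adj_sigma, add_eq_right] at h
  rw [← H.rho_gamma (H.rho (H.sigma χ)), h, map_zero]

/-- `F = U ⊕ U*`. -/
def equivF : (H.U.carrier × InvDual Λ H.U.carrier) ≃ₗ[Λ] z.F where
  __ := (z.gamma ∘ₗ H.j).coprod H.sigma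
  invFun := H.rho.prod (adj (z.mu ∘ₗ H.j))
  left_inv := by
    rintro ⟨u, χ⟩
    refine Prod.ext ?_ ?_
    · simp [H.rho_gamma, H.rho_sigma]
    · change adj (z.mu ∘ₗ H.j) (z.gamma (H.j u) + H.sigma χ) = χ
      rw [map_add, H.adj_sigma, add_eq_right]
      ext u'
      simp [H.mu_j_gamma_j]
  right_inv w := H.decomp w

/-- The component `G → U` of `μ` complementary to `(μ j)^* γ`. -/
noncomputable def delta : z.G →ₗ[Λ] H.U.carrier :=
  (evEquiv Λ H.U.carrier).symm ∘ₗ dualMap H.sigma ∘ₗ z.mu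

theorem mu_sigma_apply (g : z.G) (χ : InvDual Λ H.U.carrier) :
    z.mu g (H.sigma χ) = star (χ (H.delta g)) := by
  simp [delta]

theorem delta_j (u : H.U.carrier) : H.delta (H.j u) = u := by
  refine eq_of_forall_dual (Λ := Λ) fun χ => star_injective ?_
  rw [← H.mu_sigma_apply, H.mu_sigma]

/-- Split f along F = U ⊕ U*: the U*-part of f pairs with g exactly as f pairs with j δ g. -/
theorem mu_eq_add (g : z.G) (f : z.F) :
    z.mu g f = z.mu g (z.gamma (H.j (H.rho f))) + z.mu (H.j (H.delta g)) f := by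
  conv_lhs => rw [← H.decomp f]
  rw [map_add, H.mu_sigma_apply]
  simp

/-- The map `α : F → F*` of the flip-isomorphism of an elementary preformation. -/
def alphaHom : z.F →ₗ[Λ] InvDual Λ z.F :=
  -(dualMap H.rho ∘ₗ adj (z.mu ∘ₗ H.j)) - ε • (z.mu ∘ₗ H.j ∘ₗ H.rho)

theorem alphaHom_apply (f f' : z.F) : H.alphaHom f f' =
    -star (z.mu (H.j (H.rho f')) f) - ε • z.mu (H.j (H.rho f)) f' := rfl

/-- In the coordinates F = U ⊕ U*, α is minus the symmetrization of the hyperbolic ε-form. Its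
values on γ j U and on σ U* therefore determine the U*- and U-coordinates of the argument. -/
theorem alphaHom_bijective : Function.Bijective H.alphaHom := by
  have h1 : ∀ f u, H.alphaHom f (z.gamma (H.j u)) = -star (z.mu (H.j u) f) := by
    intro f u
    rw [alphaHom_apply, H.rho_gamma, mu_j_gamma_j, smul_zero, sub_zero]
  have h2 : ∀ f χ, H.alphaHom f (H.sigma χ) = -(ε • star (χ (H.rho f))) := by
    intro f χ
    simp [alphaHom_apply, H.rho_sigma, H.mu_sigma]
  constructor
  · rw [injective_iff_map_eq_zero]
    intro f hf
    have k1 : adj (z.mu ∘ₗ H.j) f = 0 := by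
      ext u
      have := h1 f u
      rw [hf] at this
      simpa using this
    have k2 : H.rho f = 0 := by
      refine eq_of_forall_dual (Λ := Λ) fun χ => ?_
      have := h2 f χ
      rw [hf] at this
      have k : star (χ (H.rho f)) = 0 := by
        rcases Int.units_eq_one_or ε with rfl | rfl <;> simpa using this.symm
      simpa using k
    rw [← H.decomp f, k1, k2]
    simp
  · intro φ
    let χ : InvDual Λ H.U.carrier := -dualMap (z.gamma ∘ₗ H.j) φ
    let u : H.U.carrier := -(ε • (evEquiv Λ H.U.carrier).symm (dualMap H.sigma φ))
    have hu : ∀ χ : InvDual Λ H.U.carrier, star (χ u) = -(ε • φ (H.sigma χ)) := by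
      intro χ
      rcases Int.units_eq_one_or ε with rfl | rfl <;> simp [u]
    refine ⟨z.gamma (H.j u) + H.sigma χ, ?_⟩
    ext f
    rw [← H.decomp f, map_add, map_add φ, h1, h2, map_add, map_add, H.rho_gamma, H.rho_sigma,
      mu_j_gamma_j, H.mu_sigma, zero_add, add_zero, hu]
    rcases Int.units_eq_one_or ε with rfl | rfl <;> simp [χ]

/-- The automorphism `β` of the flip-isomorphism of an elementary preformation. -/
noncomputable def betaHom : z.G →ₗ[Λ] z.G :=
  LinearMap.id - H.j ∘ₗ (H.delta + H.rho ∘ₗ z.gamma)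

theorem betaHom_apply (g : z.G) :
    H.betaHom g = g - (H.j (H.delta g) + H.j (H.rho (z.gamma g))) := by
  simp [betaHom]

/-- Both δ and ρ γ restrict to the identity on jU, so β interchanges δ with -ρ γ, and the correction
terms cancel on the second application. -/
theorem betaHom_betaHom (g : z.G) : H.betaHom (H.betaHom g) = g := by
  rw [betaHom_apply (g := H.betaHom g), betaHom_apply]
  simp only [map_sub, map_add, H.delta_j, H.rho_gamma]
  abel

/-- This is the first flip condition with ν = 0. By the (-ε)-symmetry of γ*μ, the U*-component of γ
g is -ε times the restriction of μ g to γ j U. The remaining components ρ γ of γ and δ of μ are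
interchanged up to sign by β, as α requires. -/
theorem alphaHom_gamma (g : z.G) : H.alphaHom (z.gamma g) = ε • z.mu (H.betaHom g) := by
  ext f
  rw [alphaHom_apply, z.mu_gamma (H.j (H.rho f)) g, betaHom_apply]
  simp only [map_sub, map_add, InvDual.units_smul_apply, InvDual.sub_apply, InvDual.add_apply]
  rw [H.mu_eq_add g f]
  rcases Int.units_eq_one_or ε with rfl | rfl <;> simp <;> abel

/-- The second flip condition, in dual form; it rests on ρ γ β = -δ. -/
theorem alphaHom_gamma_betaHom (f : z.F) (g : z.G) :
    H.alphaHom f (z.gamma (H.betaHom g)) = star (z.mu g f) := by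
  have h : H.rho (z.gamma (H.betaHom g)) = -H.delta g := by
    rw [betaHom_apply]
    simp [H.rho_gamma]
  have h2 : z.mu (H.betaHom g) (z.gamma (H.j (H.rho f))) = z.mu g (z.gamma (H.j (H.rho f))) := by
    rw [betaHom_apply]
    simp [H.mu_j_gamma_j]
  rw [alphaHom_apply, h, z.mu_gamma (H.j (H.rho f)), h2, H.mu_eq_add g f]
  rcases Int.units_eq_one_or ε with rfl | rfl <;> simp [add_comm]

/-- The flip-isomorphism of an elementary preformation. -/
noncomputable def flipIso : z.FlipIso where
  alpha := LinearEquiv.ofBijective H.alphaHom H.alphaHom_bijective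
  beta := LinearEquiv.ofInvolutive H.betaHom H.betaHom_betaHom
  nu := 0
  gamma_comm := by
    refine LinearMap.ext fun g => ?_
    have h : dualMap (dualMap (LinearEquiv.ofBijective H.alphaHom H.alphaHom_bijective :
        z.F →ₗ[Λ] InvDual Λ z.F)) (adj (QGroup.symm (0 : QGroup Λ (InvDual Λ z.F) (-ε)))
          (z.mu g)) = 0 := by
      rw [map_zero]
      ext x
      simp
    refine (congrArg (ev Λ (InvDual Λ z.F) (H.alphaHom (z.gamma g)) + ·) h).trans ?_
    rw [add_zero, alphaHom_gamma]
    rfl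
  mu_comm := by
    refine LinearMap.ext fun g => InvDual.ext fun φ => ?_
    obtain ⟨f, rfl⟩ := (LinearEquiv.ofBijective H.alphaHom H.alphaHom_bijective).surjective φ
    refine (congrArg (z.mu g) (LinearEquiv.symm_apply_apply _ f)).trans ?_
    refine Eq.trans ?_ (congrArg star (H.alphaHom_gamma_betaHom f g)).symm
    rw [star_star]
  theta_comm := by
    have h : QGroup.map H.betaHom z.theta = -z.theta := by
      let D := H.delta + H.rho ∘ₗ z.gamma
      -- Here β = 1 - j D and θ vanishes on jU, so β changes θ by minus the class of D* j*(1 + T)θ.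
      -- This class has to be 2θ, which is the class of (1 + T)θ.
      have e : QGroup.mk (-ε) (QGroup.symm z.theta - dualMap (H.j ∘ₗ D) ∘ₗ QGroup.symm z.theta)
          = 0 := by
        refine QGroup.mk_eq_zero_of_apply
          (-(dualMap (H.j ∘ₗ H.delta) ∘ₗ QGroup.symm z.theta)) fun x y => ?_
        rw [z.compat]
        change z.mu x (z.gamma y) - z.mu x (z.gamma (H.j (H.delta y + H.rho (z.gamma y)))) =
          -z.mu x (z.gamma (H.j (H.delta y))) -
            -ε • star (-z.mu y (z.gamma (H.j (H.delta x))))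
        rw [map_add, map_add, map_add, H.mu_eq_add x (z.gamma y),
          z.mu_gamma (H.j (H.delta x)) y]
        rcases Int.units_eq_one_or ε with rfl | rfl <;> simp <;> abel
      rw [QGroup.mk_sub, QGroup.mk_symm, sub_eq_zero] at e
      rw [betaHom, QGroup.map_sub_map, QGroup.map_id, ← QGroup.map_map, H.theta_zero, map_zero,
        add_zero]
      change z.theta - QGroup.mk (-ε) (dualMap (H.j ∘ₗ D) ∘ₗ QGroup.symm z.theta) = _
      rw [← e]
      abel
    rw [map_zero, add_zero]
    refine Eq.trans ?_ (map_neg (QGroup.map H.betaHom) z.theta).symm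
    rw [h, neg_neg]

end HSplitting

/-! ### Extending a formation to an isometry of hyperbolic forms -/

/-- A splitting of `(γ, μ)^* : F ⊕ F* → G*` whose kernel is the image of `G`. -/
structure DualSplitting (z : Preformation Λ ε) where
  gammaT : InvDual Λ z.G →ₗ[Λ] z.F
  muT : InvDual Λ z.G →ₗ[Λ] InvDual Λ z.F
  retract : ∀ x g, muT x (z.gamma g) + ε • star (z.mu g (gammaT x)) = x g
  exact_of_annihilates : ∀ (a : z.F) (f : InvDual Λ z.F),
    (∀ g, f (z.gamma g) + ε • star (z.mu g a) = 0) → ∃ g, z.gamma g = a ∧ z.mu g = f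

/-- A projection of F ⊕ F* onto the summand G is dualized through the non-singular hyperbolic form
to give (γt, μt). Exactness says that the lagrangian contains its own annihilator. -/
theorem IsNonsingularFormation.exists_dualSplitting {z : Preformation Λ ε}
    (h : z.IsNonsingularFormation) : Nonempty (DualSplitting z) := by
  obtain ⟨hinj, ⟨V, hV⟩, -, hker⟩ := h
  let S : (z.F × InvDual Λ z.F) ≃ₗ[Λ] InvDual Λ (z.F × InvDual Λ z.F) :=
    LinearEquiv.ofBijective (QGroup.symm (QGroup.mk ε (hypMap Λ z.F))) QGroup.hyp_bijective
  let I := LinearEquiv.ofInjective _ hinj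
  let r : z.F × InvDual Λ z.F →ₗ[Λ] z.G := I.symm ∘ₗ Submodule.projectionOnto _ _ hV
  have hr : ∀ g, r (z.gamma g, z.mu g) = g := by
    intro g
    change I.symm (Submodule.projectionOnto _ _ hV (I g : z.F × InvDual Λ z.F)) = g
    rw [Submodule.projectionOnto_apply_left, LinearEquiv.symm_apply_apply]
  let s : InvDual Λ z.G →ₗ[Λ] z.F × InvDual Λ z.F := S.symm ∘ₗ dualMap r
  have hs : ∀ x y, QGroup.symm (QGroup.mk ε (hypMap Λ z.F)) (s x) y = x (r y) := fun x y =>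
    DFunLike.congr_fun (S.apply_symm_apply (dualMap r x)) y
  refine ⟨⟨LinearMap.fst Λ _ _ ∘ₗ s, LinearMap.snd Λ _ _ ∘ₗ s, fun x g => ?_,
    fun a f h => ?_⟩⟩
  · have := hs x (z.gamma g, z.mu g)
    rw [hr] at this
    exact this
  · have hm : (a, f) ∈ LinearMap.range (z.gamma.prod z.mu) := by
      rw [← hker, LinearMap.mem_ker]
      ext ⟨_, g, rfl⟩
      exact h g
    obtain ⟨g, hg⟩ := hm
    exact ⟨g, congrArg Prod.fst hg, congrArg Prod.snd hg⟩

namespace DualSplitting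

/-- The sum of dual splittings. -/
def sum {z y : Preformation Λ ε} (s : DualSplitting z) (t : DualSplitting y) :
    DualSplitting (z.sum y) where
  gammaT := s.gammaT.prodMap t.gammaT ∘ₗ
    (dualProd Λ z.G y.G : InvDual Λ (z.G × y.G) →ₗ[Λ] _)
  muT := ((dualProd Λ z.F y.F).symm : _ →ₗ[Λ] InvDual Λ (z.F × y.F)) ∘ₗ
    s.muT.prodMap t.muT ∘ₗ (dualProd Λ z.G y.G : InvDual Λ (z.G × y.G) →ₗ[Λ] _)
  retract x g := by
    obtain ⟨⟨x1, x2⟩, rfl⟩ := (dualProd Λ z.G y.G).symm.surjective x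
    obtain ⟨g1, g2⟩ := g
    have h : dualProd Λ z.G y.G ((dualProd Λ z.G y.G).symm (x1, x2)) = (x1, x2) :=
      LinearEquiv.apply_symm_apply _ _
    refine (congrArg (fun p : InvDual Λ z.G × InvDual Λ y.G =>
      (s.muT p.1 (z.gamma g1) + t.muT p.2 (y.gamma g2)) +
        ε • star (z.mu g1 (s.gammaT p.1) + y.mu g2 (t.gammaT p.2))) h).trans ?_
    change _ = x1 g1 + x2 g2
    rw [← s.retract x1 g1, ← t.retract x2 g2, star_add, smul_add]
    abel
  exact_of_annihilates a f h := by
    obtain ⟨⟨f1, f2⟩, rfl⟩ := (dualProd Λ z.F y.F).symm.surjective f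
    obtain ⟨a1, a2⟩ := a
    obtain ⟨g1, h1, k1⟩ := s.exact_of_annihilates a1 f1 fun g => by
      have : f1 (z.gamma g) + f2 (y.gamma 0) + ε • star (z.mu g a1 + y.mu 0 a2) = 0 := h (g, 0)
      simpa using this
    obtain ⟨g2, h2, k2⟩ := t.exact_of_annihilates a2 f2 fun g => by
      have : f1 (z.gamma 0) + f2 (y.gamma g) + ε • star (z.mu 0 a1 + y.mu g a2) = 0 := h (0, g)
      simpa using this
    refine ⟨(g1, g2), Prod.ext h1 h2, ?_⟩
    rw [← k1, ← k2]
    rfl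

/-- The evident dual splitting of a boundary. -/
def boundary (K : FreeMod Λ) (θ : QGroup Λ K.carrier (-ε)) : DualSplitting (boundary K θ) where
  gammaT := 0
  muT := LinearMap.id
  retract x g := by
    change x g + ε • star (QGroup.symm θ g 0) = x g
    simp
  exact_of_annihilates a f h := by
    refine ⟨a, rfl, ?_⟩
    ext g
    have h1 : f g + ε • star (QGroup.symm θ g a) = 0 := h g
    exact (QGroup.symm_neg_smul θ a g).trans (eq_neg_of_add_eq_zero_left h1).symm

/-- A dual splitting can be corrected to an extension of `(γ, μ)` to an isometry. -/
theorem exists_extension {z : Preformation Λ ε} (s : DualSplitting z) : Nonempty z.Extension := by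
  obtain ⟨θ, hθ⟩ := QGroup.exists_rep z.theta
  have hθ2 : ∀ g g', z.mu g (z.gamma g') = θ g g' - ε • star (θ g' g) := by
    intro g g'
    have h := DFunLike.congr_fun (DFunLike.congr_fun z.compat g) g'
    rw [← hθ, QGroup.symm_mk_apply, Units.neg_smul, ← sub_eq_add_neg] at h
    exact h.symm
  -- Adding (γ, μ) τ to (γt, μt) keeps its pairing with G up to terms that cancel. By `retract`, the
  -- choice x(τ x') = -μt x (γt x') removes the self-pairing of the complement up to the form θt - ε
  -- θt* with θt = γt*μτ + τ*θτ.
  let τ : InvDual Λ z.G →ₗ[Λ] z.G :=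
    -((evEquiv Λ z.G).symm ∘ₗ adj (dualMap s.gammaT ∘ₗ s.muT))
  have hτ : ∀ x x' : InvDual Λ z.G, x (τ x') = -s.muT x (s.gammaT x') := by
    intro x x'
    simp [τ]
  let γt := s.gammaT + z.gamma ∘ₗ τ
  let μt := s.muT + z.mu ∘ₗ τ
  have hret : ∀ x g, μt x (z.gamma g) + ε • star (z.mu g (γt x)) = x g := by
    intro x g
    rw [← s.retract x g]
    simp only [γt, μt, LinearMap.add_apply, InvDual.add_apply, LinearMap.comp_apply, map_add,
      star_add, smul_add, z.mu_gamma (τ x) g]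
    abel
  let θt : InvDual Λ z.G →ₗ[Λ] InvDual Λ (InvDual Λ z.G) :=
    dualMap s.gammaT ∘ₗ z.mu ∘ₗ τ + dualMap τ ∘ₗ θ ∘ₗ τ
  have hθt : ∀ x x', μt x (γt x') = θt x x' - ε • star (θt x' x) := by
    intro x x'
    have h1 := s.retract x (τ x')
    rw [hτ, ← eq_sub_iff_add_eq] at h1
    change (s.muT x + z.mu (τ x)) (s.gammaT x' + z.gamma (τ x')) =
      (z.mu (τ x) (s.gammaT x') + θ (τ x) (τ x')) -
        ε • star (z.mu (τ x') (s.gammaT x) + θ (τ x') (τ x))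
    rw [InvDual.add_apply, map_add, map_add, h1, hθ2, star_add, smul_add]
    abel
  refine ⟨⟨θ, hθ, γt, μt, θt, ⟨?_, ?_⟩, ?_⟩⟩
  · rw [injective_iff_map_eq_zero]
    rintro ⟨g, x⟩ h
    have h1 : z.gamma g + γt x = 0 := congrArg Prod.fst h
    have h2 : z.mu g + μt x = 0 := congrArg Prod.snd h
    have hx : x = 0 := by
      ext g'
      rw [← hret x g', eq_neg_of_add_eq_zero_right h1, eq_neg_of_add_eq_zero_right h2]
      simp only [InvDual.neg_apply, InvDual.zero_apply, map_neg, star_neg, smul_neg,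
        z.mu_gamma g g']
      abel
    subst hx
    rw [map_zero, add_zero] at h1 h2
    refine Prod.ext (eq_of_forall_dual (Λ := Λ) fun x => ?_) rfl
    rw [← hret x g, h1, h2]
    simp
  · rintro ⟨a, f⟩
    -- The G*-coordinate must be the pairing of (a, f) with G, because G pairs trivially with
    -- itself. The remainder then annihilates G, so exactness places it in the image of G.
    let x : InvDual Λ z.G := dualMap z.gamma f + ε • adj z.mu a
    obtain ⟨g, hg, hg'⟩ := s.exact_of_annihilates (a - γt x) (f - μt x) fun g => by
      have h : μt x (z.gamma g) + ε • star (z.mu g (γt x)) =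
        f (z.gamma g) + ε • star (z.mu g a) := hret x g
      rw [InvDual.sub_apply, map_sub, star_sub, smul_sub]
      rw [← sub_eq_zero] at h
      rw [← neg_eq_zero, ← h]
      abel
    refine ⟨(g, x), Prod.ext ?_ ?_⟩
    · change z.gamma g + γt x = a
      rw [hg, sub_add_cancel]
    · change z.mu g + μt x = f
      rw [hg', sub_add_cancel]
  · refine LinearMap.ext fun ⟨g, x⟩ => InvDual.ext fun ⟨g', x'⟩ => ?_
    change (z.mu g + μt x) (z.gamma g' + γt x') - x g' =
      (θ g g' + z.mu g (γt x') + θt x x') - ε • star (θ g' g + z.mu g' (γt x) + θt x' x)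
    rw [InvDual.add_apply, map_add, map_add, hθt, hθ2, ← hret x g']
    simp only [star_add, smul_add]
    abel

end DualSplitting

end Preformation
-- Vanishing of the signature for elementary classes
theorem QGroup.map_prodComm_sum {Λ : Type*} [Ring Λ] [StarRing Λ] {ε : ℤˣ} {M N : Type*}
    [AddCommGroup M] [Module Λ M] [AddCommGroup N] [Module Λ N] (x : QGroup Λ M ε)
    (y : QGroup Λ N ε) :
    QGroup.map (LinearEquiv.prodComm Λ M N : M × N →ₗ[Λ] N × M) (QGroup.sum y x) =
      QGroup.sum x y := by
  simp only [QGroup.sum, map_add, QGroup.map_map]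
  exact add_comm _ _

theorem NSForm.Isometric.sum_comm {Λ : Type u} [Ring Λ] [StarRing Λ] {ε : ℤˣ} (A B : NSForm Λ ε) :
    Isometric (A.sum B) (B.sum A) :=
  ⟨LinearEquiv.prodComm Λ A.M B.M, QGroup.map_prodComm_sum A.psi B.psi⟩

namespace Preformation

variable {Λ : Type u} [Ring Λ] [StarRing Λ] {ε : ℤˣ}

theorem quadraticSignature_eq_zero_of_isometric {z : Preformation Λ ε} (t : z.FlipIso)
    (e : z.Extension) (ν : InvDual Λ z.F →ₗ[Λ] InvDual Λ (InvDual Λ z.F))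
    (hν : QGroup.mk (-ε) ν = t.nu) (L : FreeMod Λ)
    (h : NSForm.Isometric (⟨z.SigModule, QGroup.mk (-ε) (sigMap z t e ν),
      sigMap_bijective z t e ν hν⟩ : NSForm Λ (-ε)) (NSForm.hyp (-ε) L)) :
    z.quadraticSignature t e ν hν = 0 := by
  exact Quotient.sound ⟨⟨PUnit⟩, L, (h.sum_right _).trans (NSForm.Isometric.sum_comm _ _)⟩

namespace HSplitting

variable {z : Preformation Λ ε} (H : HSplitting z)

/-- The quadratic signature of the flip-isomorphism of an elementary preformation vanishes. -/
theorem quadraticSignature_flipIso [IsStablyFiniteRing Λ] (e : z.Extension) :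
    z.quadraticSignature H.flipIso e 0 rfl = 0 := by
  obtain ⟨d⟩ := exists_equiv_dual (Λ := Λ) (M := H.U.carrier)
  have ha : ∀ f f', H.flipIso.a f f' = H.alphaHom f f' := fun _ _ => rfl
  -- The isotropic submodule consists of the vectors (x, j u, ε γt x + γ j v) with x zero on jU.
  -- Since G* is the annihilator of jU plus a copy of U*, and d identifies U with U*, one element of
  -- G* encodes both x and u.
  let c : InvDual Λ z.G →ₗ[Λ] H.U.carrier := d.symm ∘ₗ dualMap H.j
  let x₀ : InvDual Λ z.G →ₗ[Λ] InvDual Λ z.G :=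
    LinearMap.id - dualMap (H.rho ∘ₗ z.gamma) ∘ₗ dualMap H.j
  have hx₀ : ∀ x u, x₀ x (H.j u) = 0 := by
    intro x u
    simp [x₀, H.rho_gamma]
  let L : FreeMod Λ := ⟨InvDual Λ z.G × H.U.carrier⟩
  let i₁ : InvDual Λ z.G × H.U.carrier →ₗ[Λ] InvDual Λ z.G := x₀ ∘ₗ LinearMap.fst Λ _ _
  let i₂ : InvDual Λ z.G × H.U.carrier →ₗ[Λ] H.U.carrier := c ∘ₗ LinearMap.fst Λ _ _
  let i₃ : InvDual Λ z.G × H.U.carrier →ₗ[Λ] z.F :=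
    ε • (e.gammaT ∘ₗ i₁) + z.gamma ∘ₗ H.j ∘ₗ LinearMap.snd Λ _ _
  let i : InvDual Λ z.G × H.U.carrier →ₗ[Λ] z.SigModule := i₁.prod ((H.j ∘ₗ i₂).prod i₃)
  let p : z.SigModule →ₗ[Λ] InvDual Λ z.G × H.U.carrier :=
    (z.sigPr1 + dualMap (H.rho ∘ₗ z.gamma) ∘ₗ d ∘ₗ H.rho ∘ₗ z.gamma ∘ₗ z.sigPr2).prod
      (H.rho ∘ₗ (z.sigPr3 - ε • (e.gammaT ∘ₗ z.sigPr1)))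
  refine quadraticSignature_eq_zero_of_isometric _ e 0 rfl L
    (NSForm.isometric_hyp_of_isotropic _ L i p ?_ ?_ ?_)
  · refine LinearMap.ext fun ⟨x, u⟩ => Prod.ext ?_ ?_
    · change x₀ x + dualMap (H.rho ∘ₗ z.gamma)
        (d (H.rho (z.gamma (H.j (d.symm (dualMap H.j x)))))) = x
      rw [H.rho_gamma, LinearEquiv.apply_symm_apply]
      simp [x₀]
    · change H.rho (ε • e.gammaT (x₀ x) + z.gamma (H.j u) - ε • e.gammaT (x₀ x)) = u
      rw [add_sub_cancel_left, H.rho_gamma]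
  · have hθ : QGroup.mk (-ε) (ε • adj (QGroup.pull (H.j ∘ₗ i₂) e.theta)) = 0 := by
      have h1 : QGroup.mk (-ε) (QGroup.pull (H.j ∘ₗ i₂) e.theta) = 0 := by
        rw [← QGroup.map_mk, e.theta_mk, ← QGroup.map_map, H.theta_zero, map_zero]
      rw [← QGroup.mk_units_smul_adj, Units.neg_smul, QGroup.mk_neg] at h1
      exact neg_eq_zero.1 h1
    -- The adjoint of α is 1 - T_{-ε} applied to -μ j ρ, hence trivial in Q_{-ε}.
    have hα : QGroup.mk (-ε) (QGroup.pull (e.gammaT ∘ₗ i₁) (adj H.alphaHom)) = 0 := by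
      refine QGroup.mk_eq_zero_of_apply
        (-(QGroup.pull (e.gammaT ∘ₗ i₁) (z.mu ∘ₗ H.j ∘ₗ H.rho))) fun l l' => ?_
      simp only [QGroup.pull_apply, adj_apply, H.alphaHom_apply, LinearMap.neg_apply,
        InvDual.neg_apply, LinearMap.comp_apply]
      rcases Int.units_eq_one_or ε with rfl | rfl <;> simp
    have hsum : QGroup.pull i (sigMap z H.flipIso e 0) =
        ε • adj (QGroup.pull (H.j ∘ₗ i₂) e.theta) +
          QGroup.pull (e.gammaT ∘ₗ i₁) (adj H.alphaHom) := by
      refine LinearMap.ext fun ⟨x, s⟩ => InvDual.ext fun ⟨x', s'⟩ => ?_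
      change sigMap z H.flipIso e 0
        (x₀ x, H.j (c x), ε • e.gammaT (x₀ x) + z.gamma (H.j s))
        (x₀ x', H.j (c x'), ε • e.gammaT (x₀ x') + z.gamma (H.j s')) =
        ε • star (e.theta (H.j (c x')) (H.j (c x))) +
          star (H.alphaHom (e.gammaT (x₀ x')) (e.gammaT (x₀ x)))
      have hβ : ∀ u, z.mu (H.betaHom (H.j u)) = -z.mu (H.j u) := by
        intro u
        rw [betaHom_apply, H.delta_j, H.rho_gamma]
        simp
      -- As x₀ x vanishes on jU, this identity of the extension cancels the μt-term on γ j s'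
      -- against the α-term, which equals minus a μ-term since β = -1 on jU.
      have h1 := DFunLike.congr_fun (e.eq1 (x₀ x)) (H.j s')
      rw [hx₀] at h1
      simp only [InvDual.add_apply, dualMap_apply, InvDual.units_smul_apply, adj_apply] at h1
      have h2 := H.mu_j_gamma_j (c x) s'
      rw [sigMap_apply]
      simp only [ha, map_add, InvDual.add_apply, H.alphaHom_gamma, hβ, h2]
      rw [eq_neg_of_add_eq_zero_left h1]
      rcases Int.units_eq_one_or ε with rfl | rfl <;> simp <;> abel
    change QGroup.mk (-ε) (QGroup.pull i (sigMap z H.flipIso e 0)) = 0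
    rw [hsum, QGroup.mk_add, hθ, hα, add_zero]
  · let D := evEquiv Λ z.G
    let e₁ : InvDual Λ (InvDual Λ z.G × H.U.carrier) ≃ₗ[Λ] z.G × InvDual Λ H.U.carrier :=
      (dualProd Λ (InvDual Λ z.G) H.U.carrier).trans
        (LinearEquiv.prodCongr D.symm (LinearEquiv.refl Λ _))
    exact ((LinearEquiv.prodCongr (LinearEquiv.refl Λ _) e₁).trans
      (LinearEquiv.prodProdProdComm Λ _ _ _ _)).trans
      ((LinearEquiv.prodAssoc Λ _ _ _).trans (LinearEquiv.prodCongr (LinearEquiv.refl Λ _)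
        (LinearEquiv.prodCongr (LinearEquiv.refl Λ _) H.equivF)))

end HSplitting

/-- Both structures must live on one preformation. The sum of z' with ∂H(P') inherits the splitting
through the strong isomorphism and the extension from the non-singularity of z'. -/
theorem exists_signature_zero_of_classIsElementary [IsStablyFiniteRing Λ]
    {z' : Preformation Λ ε} (hz' : z'.IsNonsingularFormation) (h : z'.ClassIsElementary) :
    ∃ z : Preformation Λ ε, StablyStronglyIso z z' ∧
      ∃ (t : z.FlipIso) (e : z.Extension) (ν : InvDual Λ z.F →ₗ[Λ] InvDual Λ (InvDual Λ z.F))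
        (hν : QGroup.mk (-ε) ν = t.nu), z.quadraticSignature t e ν hν = 0 := by
  obtain ⟨y, ⟨P, P', ⟨s⟩⟩, hy⟩ := h
  obtain ⟨H⟩ := hy.exists_hSplitting
  obtain ⟨S⟩ := hz'.exists_dualSplitting
  let H' : HSplitting (z'.sum (boundaryHyp ε P')) :=
    (H.sum (HSplitting.boundaryHyp ε P)).transport s
  obtain ⟨e⟩ := (S.sum (DualSplitting.boundary ⟨P'.carrier × InvDual Λ P'.carrier⟩
    (QGroup.mk (-ε) (hypMap Λ P'.carrier)))).exists_extension
  exact ⟨z'.sum (boundaryHyp ε P'), stablyStronglyIso_sum_boundaryHyp z' P', H'.flipIso, e, 0,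
    rfl, H'.quadraticSignature_flipIso e⟩

end Preformation
-- Witt-trivial forms inside preformations
section

variable {Λ : Type u} [Ring Λ] [StarRing Λ] {ε : ℤˣ}

namespace NSForm

/-- The isometry with H(0) ⊕ H(Q) pulls back the first half Q of H(Q), together with the projection
onto it. -/
theorem WittEquiv.exists_lagrangian (A : NSForm Λ ε)
    (h : WittEquiv A (hyp ε ⟨PUnit⟩)) :
    ∃ (P Q : FreeMod Λ) (i : Q.carrier →ₗ[Λ] A.M × (P.carrier × InvDual Λ P.carrier))
      (p : A.M × (P.carrier × InvDual Λ P.carrier) →ₗ[Λ] Q.carrier),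
      p ∘ₗ i = LinearMap.id ∧
      QGroup.map i (QGroup.sum A.psi (QGroup.mk ε (hypMap Λ P.carrier))) = 0 ∧
      Nonempty ((Q.carrier × InvDual Λ Q.carrier) ≃ₗ[Λ]
        A.M × (P.carrier × InvDual Λ P.carrier)) := by
  obtain ⟨P, Q, E, hE⟩ := h
  let E' : (A.M × (P.carrier × InvDual Λ P.carrier)) ≃ₗ[Λ]
    ((PUnit.{u+1} × InvDual Λ PUnit.{u+1}) × (Q.carrier × InvDual Λ Q.carrier)) := E
  let k : Q.carrier →ₗ[Λ]
      (PUnit.{u+1} × InvDual Λ PUnit.{u+1}) × (Q.carrier × InvDual Λ Q.carrier) :=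
    LinearMap.inr Λ _ _ ∘ₗ LinearMap.inl Λ _ _
  refine ⟨P, Q, E'.symm ∘ₗ k, LinearMap.fst Λ _ _ ∘ₗ LinearMap.snd Λ _ _ ∘ₗ
    E'.toLinearMap, ?_, ?_, ?_⟩
  · ext x
    simp [k]
  · have h1 : QGroup.map E'.symm.toLinearMap
        (QGroup.sum A.psi (QGroup.mk ε (hypMap Λ P.carrier))) =
        QGroup.sum (QGroup.mk ε (hypMap Λ PUnit.{u+1})) (QGroup.mk ε (hypMap Λ Q.carrier)) := by
      refine (congrArg _ hE.symm).trans ?_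
      refine (QGroup.map_map _ _ _).trans ?_
      have : E'.toLinearMap ∘ₗ E'.symm.toLinearMap =
        LinearMap.id := by ext x <;> simp
      exact (congrArg (fun f => QGroup.map f _) this).trans (QGroup.map_id _)
    rw [← QGroup.map_map, h1]
    refine QGroup.mk_eq_zero_of_apply 0 fun x y => ?_
    change (0 : InvDual Λ PUnit.{u+1}) 0 + (0 : InvDual Λ Q.carrier) y =
      (0 : InvDual Λ Q.carrier) y - ε • star ((0 : InvDual Λ Q.carrier) x)
    simp
  · let u : Unique (PUnit.{u+1} × InvDual Λ PUnit.{u+1}) :=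
      { default := 0
        uniq := fun x => Prod.ext rfl (InvDual.ext fun y => by
          rw [Subsingleton.elim y 0, map_zero, map_zero]) }
    exact ⟨LinearEquiv.uniqueProd.symm.trans E'.symm⟩

end NSForm

namespace QGroup

/-- The hyperbolic form is isometric to its negative, so a lagrangian of A ⊕ H(P) can be carried
over to -A ⊕ H(P). -/
theorem map_neg_hyp (P : Type*) [AddCommGroup P] [Module Λ P] :
    map (LinearMap.id.prodMap (-LinearMap.id) : P × InvDual Λ P →ₗ[Λ] P × InvDual Λ P)
      (mk ε (hypMap Λ P)) = -mk ε (hypMap Λ P) := by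
  rw [map_mk, ← mk_neg]
  rfl

end QGroup

namespace Preformation

/-- A Witt-trivial form embedded in a preformation with reversed sign, together with a
complementary isotropic piece, makes the preformation elementary after stabilization. -/
theorem exists_isElementary_sum_of_embedding [IsStablyFiniteRing Λ] (w : Preformation Λ ε)
    (A : NSForm Λ (-ε)) (hA : NSForm.WittEquiv A (NSForm.hyp (-ε) ⟨PUnit⟩))
    (V : FreeMod Λ) (T : A.M × V.carrier →ₗ[Λ] w.G)
    (hT : QGroup.map T w.theta = QGroup.map (LinearMap.fst Λ A.M V.carrier) (-A.psi))
    (R : w.F →ₗ[Λ] A.M × V.carrier) (hR : ∀ q, R (w.gamma (T q)) = q)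
    (R' : InvDual Λ w.F →ₗ[Λ] A.M × V.carrier) (hR' : ∀ q, R' (w.mu (T q)) = q)
    (e : (A.M × (V.carrier × InvDual Λ V.carrier)) ≃ₗ[Λ] w.F) :
    ∃ P : FreeMod Λ, (w.sum (boundaryHyp ε P)).IsElementary := by
  obtain ⟨P, Q, i, p, hp, hi, ⟨d⟩⟩ := hA.exists_lagrangian
  have hpi : ∀ x, p (i x) = x := fun x => DFunLike.congr_fun hp x
  refine ⟨P, ?_⟩
  let N : P.carrier × InvDual Λ P.carrier →ₗ[Λ] P.carrier × InvDual Λ P.carrier :=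
    LinearMap.id.prodMap (-LinearMap.id)
  have hN : ∀ x, N (N x) = x := fun x => Prod.ext rfl (neg_neg x.2)
  let S : (P.carrier × InvDual Λ P.carrier) ≃ₗ[Λ]
      InvDual Λ (P.carrier × InvDual Λ P.carrier) :=
    LinearEquiv.ofBijective _ (QGroup.hyp_bijective (ε := -ε))
  let i₁ : Q.carrier →ₗ[Λ] A.M := LinearMap.fst Λ _ _ ∘ₗ i
  let i₂ : Q.carrier →ₗ[Λ] P.carrier × InvDual Λ P.carrier := LinearMap.snd Λ _ _ ∘ₗ i
  -- Q is isotropic in A ⊕ H(P). Through T and the sign change N it becomes isotropic in w ⊕ ∂H(P).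
  -- V can be added because the form pulled back along T does not involve V.
  let T' : Q.carrier × V.carrier →ₗ[Λ] w.G × (P.carrier × InvDual Λ P.carrier) :=
    (T ∘ₗ i₁.prodMap LinearMap.id).prod (N ∘ₗ i₂ ∘ₗ LinearMap.fst Λ _ _)
  let q : (A.M × V.carrier) × (P.carrier × InvDual Λ P.carrier) →ₗ[Λ] Q.carrier × V.carrier :=
    (p ∘ₗ (LinearMap.fst Λ _ _).prodMap N).prod
      (LinearMap.snd Λ _ _ ∘ₗ LinearMap.fst Λ _ _)
  have hq : ∀ x : Q.carrier × V.carrier, q ((i₁ x.1, x.2), N (i₂ x.1)) = x := by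
    intro x
    refine Prod.ext ?_ rfl
    change p (i₁ x.1, N (N (i₂ x.1))) = x.1
    rw [hN]
    exact hpi x.1
  refine isElementary_of_split (w.sum (boundaryHyp ε P)) (Q.prod V) T' ?_
    (q ∘ₗ R.prodMap LinearMap.id) (fun x => ?_)
    (q ∘ₗ R'.prodMap (S.symm : _ →ₗ[Λ] P.carrier × InvDual Λ P.carrier) ∘ₗ
      (dualProd Λ w.F (P.carrier × InvDual Λ P.carrier)).toLinearMap) (fun x => ?_) ?_
  · change QGroup.map T' (QGroup.sum w.theta (QGroup.mk (-ε) (hypMap Λ P.carrier))) = 0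
    have h1 : QGroup.map T' (QGroup.sum w.theta (QGroup.mk (-ε) (hypMap Λ P.carrier))) =
        QGroup.map (i₁.prodMap (LinearMap.id : V.carrier →ₗ[Λ] V.carrier))
          (QGroup.map T w.theta) +
        QGroup.map (i₂ ∘ₗ LinearMap.fst Λ Q.carrier V.carrier)
          (QGroup.map N (QGroup.mk (-ε) (hypMap Λ P.carrier))) := by
      simp only [QGroup.sum, map_add, QGroup.map_map]
      rfl
    have h2 := congrArg (QGroup.map (LinearMap.fst Λ Q.carrier V.carrier)) hi
    simp only [QGroup.sum, map_add, QGroup.map_map, map_zero] at h2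
    rw [h1, hT, QGroup.map_neg_hyp, map_neg, map_neg, map_neg, ← neg_add, neg_eq_zero,
      QGroup.map_map]
    exact h2
  · change q (R (w.gamma (T (i₁ x.1, x.2))), N (i₂ x.1)) = x
    rw [hR]
    exact hq x
  · have h : dualProd Λ w.F (P.carrier × InvDual Λ P.carrier)
        ((w.sum (boundaryHyp ε P)).mu (T' x)) =
        (w.mu (T (i₁ x.1, x.2)), S (N (i₂ x.1))) := by
      refine Prod.ext (InvDual.ext fun f => ?_) (InvDual.ext fun f => ?_)
      · change w.mu (T (i₁ x.1, x.2)) f + S (N (i₂ x.1)) 0 = w.mu (T (i₁ x.1, x.2)) f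
        simp
      · change w.mu (T (i₁ x.1, x.2)) 0 + S (N (i₂ x.1)) f = S (N (i₂ x.1)) f
        simp
    refine (congrArg (fun y => q (R' y.1, S.symm y.2)) h).trans ?_
    simp only [hR', LinearEquiv.symm_apply_apply]
    exact hq x
  · exact ((LinearEquiv.prodCongr (LinearEquiv.refl Λ (Q.carrier × V.carrier))
      (dualProd Λ Q.carrier V.carrier)).trans
      (LinearEquiv.prodProdProdComm Λ _ _ _ _)).trans
      ((LinearEquiv.prodCongr d (LinearEquiv.refl Λ _)).trans
        ((swapEquiv Λ _ _ _).trans (LinearEquiv.prodCongr e (LinearEquiv.refl Λ _))))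

end Preformation

end

/-! ### The signature form inside a stabilization of z -/

namespace Preformation

variable {Λ : Type u} [Ring Λ] [StarRing Λ] {ε : ℤˣ}

section

variable {z : Preformation Λ ε}

namespace Extension

variable (e : z.Extension)

/-- The isometry `f` of an extension, as an isomorphism `G ⊕ G* → F ⊕ F*`. -/
noncomputable def equiv : (z.G × InvDual Λ z.G) ≃ₗ[Λ] (z.F × InvDual Λ z.F) :=
  LinearEquiv.ofBijective ((z.gamma.coprod e.gammaT).prod (z.mu.coprod e.muT)) e.bijective

/-- The component `F* → G` of `f⁻¹`. -/
noncomputable def toG : InvDual Λ z.F →ₗ[Λ] z.G :=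
  LinearMap.fst Λ _ _ ∘ₗ e.equiv.symm.toLinearMap ∘ₗ LinearMap.inr Λ _ _

/-- The component `F* → G*` of `f⁻¹`. -/
noncomputable def toDual : InvDual Λ z.F →ₗ[Λ] InvDual Λ z.G :=
  LinearMap.snd Λ _ _ ∘ₗ e.equiv.symm.toLinearMap ∘ₗ LinearMap.inr Λ _ _

/-- With the next identity this records that f maps (`toG` v, `toDual` v) to (0, v). -/
theorem gammaT_toDual (v : InvDual Λ z.F) : e.gammaT (e.toDual v) = -z.gamma (e.toG v) :=
  eq_neg_of_add_eq_zero_right (congrArg Prod.fst (e.equiv.apply_symm_apply (0, v)))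

theorem muT_toDual (v : InvDual Λ z.F) : e.muT (e.toDual v) = v - z.mu (e.toG v) :=
  eq_sub_of_add_eq' (congrArg Prod.snd (e.equiv.apply_symm_apply (0, v)))

theorem star_apply (x : InvDual Λ z.G) (g : z.G) :
    star (x g) = ε • z.mu g (e.gammaT x) + star (e.muT x (z.gamma g)) := by
  conv_lhs => rw [← e.eq1 x]
  simp only [InvDual.add_apply, dualMap_apply, InvDual.units_smul_apply, adj_apply, star_add,
    star_units_smul, star_star]
  exact add_comm _ _

end Extension

namespace FlipIso

variable (t : z.FlipIso) (e : z.Extension)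
  (ν : InvDual Λ z.F →ₗ[Λ] InvDual Λ (InvDual Λ z.F))

/-- The isomorphism `α` as a homomorphism. -/
abbrev aHom : z.F →ₗ[Λ] InvDual Λ z.F := t.a

theorem theta_eq : z.theta + QGroup.map z.mu t.nu + QGroup.map t.b.toLinearMap z.theta = 0 := by
  have h : z.theta + QGroup.map z.mu t.nu = QGroup.map t.b.toLinearMap (-z.theta) := t.theta_comm
  rw [h, map_neg, neg_add_cancel]

/-- `α*⁻¹ : F* → F`. -/
noncomputable def adjInv : InvDual Λ z.F →ₗ[Λ] z.F :=
  (evEquiv Λ z.F).symm.toLinearMap ∘ₗ dualMap t.a.symm.toLinearMap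

theorem adjInv_adj (u : z.F) : t.adjInv (adj t.aHom u) = u := by
  refine eq_of_forall_dual (Λ := Λ) fun f => ?_
  change f ((evEquiv Λ z.F).symm (dualMap t.a.symm.toLinearMap (adj t.aHom u))) = f u
  rw [apply_evEquiv_symm]
  change star (star (t.a (t.a.symm f) u)) = f u
  rw [star_star, LinearEquiv.apply_symm_apply]

/-- `β⁻¹` composed with the component `F* → G` of `f⁻¹`. -/
noncomputable def toG : InvDual Λ z.F →ₗ[Λ] z.G := t.b.symm.toLinearMap ∘ₗ e.toG

theorem b_toG (v : InvDual Λ z.F) : t.b (t.toG e v) = e.toG v :=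
  t.b.apply_symm_apply _

theorem adj_gamma_toG (v : InvDual Λ z.F) :
    adj t.aHom (z.gamma (e.toG v)) = z.mu (t.toG e v) := by
  rw [← t.b_toG e]
  exact t.mu_eq _

theorem a_gamma (g : z.G) (w : z.F) :
    t.a (z.gamma g) w = ε • QGroup.symm t.nu (z.mu g) (adj t.aHom w) + ε • z.mu (t.b g) w := by
  rw [t.gamma_eq]
  rfl

/-- The embedding of the signature form with reversed sign into the sum of `z` and `∂H(G* ⊕ F)`. -/
noncomputable def embed : z.SigModule →ₗ[Λ]
    z.G × ((InvDual Λ z.G × z.F) × InvDual Λ (InvDual Λ z.G × z.F)) :=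
  z.sigPr2.prod ((z.sigPr1.prod z.sigPr3).prod
    (-(dualMap ((LinearMap.fst Λ _ _).prod
      ((0 : InvDual Λ z.G × z.F →ₗ[Λ] z.G).prod (LinearMap.snd Λ _ _))) ∘ₗ sigMap z t e ν)))

theorem embed_snd_snd_apply (x x' : InvDual Λ z.G) (y : z.G) (w w' : z.F) :
    (t.embed e ν (x, y, w)).2.2 (x', w') =
      -(e.muT x (e.gammaT x') + ν (adj t.aHom (e.gammaT x)) (adj t.aHom (e.gammaT x'))) +
        t.a (z.gamma y) (e.gammaT x') -
        ε • (star (t.a w' (e.gammaT x)) - e.muT x w') + z.mu y w' := by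
  change -(sigMap z t e ν (x, y, w) (x', 0, w')) = _
  rw [sigMap_apply]
  simp only [map_zero, InvDual.zero_apply, star_zero, smul_zero, add_zero]
  abel

/-- The P*-coordinate of the embedding is minus ξ on G* ⊕ F, so adding ξ cancels all entries except
the block ε θ* on G. Together with θ it makes up (1 - T_{-ε})θ. -/
theorem map_embed : QGroup.map (t.embed e ν)
    (QGroup.sum z.theta (QGroup.mk (-ε) (hypMap Λ (InvDual Λ z.G × z.F)))) =
      -QGroup.mk (-ε) (sigMap z t e ν) := by
  rw [← e.theta_mk, eq_neg_iff_add_eq_zero]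
  refine QGroup.mk_eq_zero_of_apply (QGroup.pull z.sigPr2 e.theta) fun m m' => ?_
  obtain ⟨x, y, w⟩ := m
  obtain ⟨x', y', w'⟩ := m'
  change e.theta y y' + (t.embed e ν (x, y, w)).2.2 (x', w') +
    sigMap z t e ν (x, y, w) (x', y', w') = e.theta y y' - -ε • star (e.theta y' y)
  rw [embed_snd_snd_apply, sigMap_apply, Units.neg_smul]
  abel

/-- The complementary isotropic piece `F*` in the sum of `z` and `∂H(G* ⊕ F)`. -/
noncomputable def compl : InvDual Λ z.F →ₗ[Λ]
    z.G × ((InvDual Λ z.G × z.F) × InvDual Λ (InvDual Λ z.G × z.F)) :=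
  (e.toG - t.toG e).prod (((ε • e.toDual).prod (-(z.gamma ∘ₗ e.toG))).prod
    (dualMap (LinearMap.fst Λ _ _) ∘ₗ dualMap e.gammaT ∘ₗ
      (dualMap (adj t.aHom) ∘ₗ adj ν ∘ₗ z.mu ∘ₗ t.toG e + t.aHom ∘ₗ z.gamma ∘ₗ e.toG)))

theorem compl_snd_snd_apply (v : InvDual Λ z.F) (x' : InvDual Λ z.G) (w' : z.F) :
    (t.compl e ν v).2.2 (x', w') =
      star (ν (adj t.aHom (e.gammaT x')) (z.mu (t.toG e v))) +
        t.a (z.gamma (e.toG v)) (e.gammaT x') := rfl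

/-- Write a = `toG` and b = β⁻¹a. The hyperbolic coordinates contribute the classes of b*μ*νμb and
a*γ*μb, and the latter cancels the cross term in the form θ on a - b. What remains is the identity θ
+ μ*νμ + β*θβ = 0 pulled back along b. -/
theorem map_compl (hν : QGroup.mk (-ε) ν = t.nu) : QGroup.map (t.compl e ν)
    (QGroup.sum z.theta (QGroup.mk (-ε) (hypMap Λ (InvDual Λ z.G × z.F)))) = 0 := by
  have h1 : QGroup.map (t.compl e ν)
      (QGroup.sum z.theta (QGroup.mk (-ε) (hypMap Λ (InvDual Λ z.G × z.F)))) =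
      QGroup.map (e.toG - t.toG e) z.theta + QGroup.mk (-ε)
        (QGroup.pull (LinearMap.snd Λ _ _ ∘ₗ t.compl e ν) (hypMap Λ (InvDual Λ z.G × z.F))) := by
    simp only [QGroup.sum, map_add, QGroup.map_map]
    rfl
  have h2 : QGroup.pull (LinearMap.snd Λ _ _ ∘ₗ t.compl e ν) (hypMap Λ (InvDual Λ z.G × z.F)) =
      -ε • adj (QGroup.pull (z.mu ∘ₗ t.toG e) ν) +
        -ε • adj (dualMap e.toG ∘ₗ dualMap z.gamma ∘ₗ z.mu ∘ₗ t.toG e) := by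
    refine LinearMap.ext fun v => InvDual.ext fun v' => ?_
    change (t.compl e ν v).2.2 (ε • e.toDual v', -z.gamma (e.toG v')) =
      -ε • star (ν (z.mu (t.toG e v')) (z.mu (t.toG e v))) +
        -ε • star (z.mu (t.toG e v') (z.gamma (e.toG v)))
    have h3 : star (t.a (z.gamma (e.toG v)) (z.gamma (e.toG v'))) =
        z.mu (t.toG e v') (z.gamma (e.toG v)) := by
      rw [← t.adj_gamma_toG e v']
      rfl
    rw [compl_snd_snd_apply, ← h3]
    rcases Int.units_eq_one_or ε with rfl | rfl <;>
      simp [e.gammaT_toDual, t.adj_gamma_toG]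
  have h3 : QGroup.map (t.toG e) (z.theta + QGroup.map z.mu t.nu) +
      QGroup.map e.toG z.theta = 0 := by
    have h := congrArg (QGroup.map (t.toG e)) t.theta_eq
    have h4 : t.b.toLinearMap ∘ₗ t.toG e = e.toG := LinearMap.ext (t.b_toG e)
    rwa [map_add, QGroup.map_map, h4, map_zero] at h
  have h5 : QGroup.map e.toG z.theta + QGroup.map (t.toG e) z.theta +
      QGroup.mk (-ε) (QGroup.pull (z.mu ∘ₗ t.toG e) ν) = 0 := by
    rw [← h3, map_add, QGroup.map_map, ← hν, QGroup.map_mk]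
    abel
  rw [h1, h2, QGroup.mk_add, QGroup.mk_units_smul_adj, QGroup.mk_units_smul_adj, ← neg_sub (t.toG e) e.toG,
    QGroup.map_neg_map, QGroup.map_sub_map, z.compat, ← h5]
  simp only [LinearMap.comp_assoc]
  abel

/-- Orthogonality lets F* be added to any isotropic submodule of M. It supplies the rank that half
of M lacks to be half of F ⊕ H(G* ⊕ F). -/
theorem symm_embed_compl (m : z.SigModule) (v : InvDual Λ z.F) :
    QGroup.symm (QGroup.sum z.theta (QGroup.mk (-ε) (hypMap Λ (InvDual Λ z.G × z.F))))
      (t.embed e ν m) (t.compl e ν v) = 0 := by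
  obtain ⟨x, y, w⟩ := m
  rw [QGroup.symm_sum_apply, QGroup.symm_mk_apply, z.compat]
  change z.mu y (z.gamma (e.toG v - t.toG e v)) +
    ((t.embed e ν (x, y, w)).2.2 (ε • e.toDual v, -z.gamma (e.toG v)) +
      -ε • star ((t.compl e ν v).2.2 (x, w))) = 0
  have h1 : t.a (z.gamma y) (z.gamma (e.toG v)) = -(ε • z.mu y (z.gamma (t.toG e v))) := by
    have h : t.a (z.gamma y) (z.gamma (e.toG v)) = star (z.mu (t.toG e v) (z.gamma y)) := by
      rw [← t.adj_gamma_toG e v, adj_apply, star_star]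
      rfl
    rw [h, z.mu_gamma (t.toG e v) y]
    rcases Int.units_eq_one_or ε with rfl | rfl <;> simp
  rw [embed_snd_snd_apply, compl_snd_snd_apply]
  rcases Int.units_eq_one_or ε with rfl | rfl <;>
    simp [e.gammaT_toDual, t.adj_gamma_toG, h1] <;> abel

/-- The embedding together with the complementary piece. -/
noncomputable def total : z.SigModule × InvDual Λ z.F →ₗ[Λ]
    z.G × ((InvDual Λ z.G × z.F) × InvDual Λ (InvDual Λ z.G × z.F)) :=
  t.embed e ν ∘ₗ LinearMap.fst Λ _ _ + t.compl e ν ∘ₗ LinearMap.snd Λ _ _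

theorem map_total (hν : QGroup.mk (-ε) ν = t.nu) : QGroup.map (t.total e ν)
    (QGroup.sum z.theta (QGroup.mk (-ε) (hypMap Λ (InvDual Λ z.G × z.F)))) =
      QGroup.map (LinearMap.fst Λ z.SigModule (InvDual Λ z.F))
        (-QGroup.mk (-ε) (sigMap z t e ν)) := by
  have h : dualMap (t.compl e ν ∘ₗ LinearMap.snd Λ z.SigModule (InvDual Λ z.F)) ∘ₗ
      QGroup.symm (QGroup.sum z.theta (QGroup.mk (-ε) (hypMap Λ (InvDual Λ z.G × z.F)))) ∘ₗ
      t.embed e ν ∘ₗ LinearMap.fst Λ z.SigModule (InvDual Λ z.F) = 0 := by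
    refine LinearMap.ext fun m => InvDual.ext fun m' => ?_
    simp only [LinearMap.comp_apply, dualMap_apply, LinearMap.fst_apply, LinearMap.snd_apply,
      LinearMap.zero_apply, InvDual.zero_apply]
    exact t.symm_embed_compl e ν m.1 m'.2
  have h1 := congrArg (QGroup.map (LinearMap.fst Λ z.SigModule (InvDual Λ z.F)))
    (t.map_embed e ν)
  have h2 := congrArg (QGroup.map (LinearMap.snd Λ z.SigModule (InvDual Λ z.F)))
    (t.map_compl e ν hν)
  rw [QGroup.map_map] at h1
  rw [QGroup.map_map, map_zero] at h2
  refine (QGroup.map_add_map _ _ _).trans ?_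
  rw [h, h2, QGroup.mk_zero, add_zero, add_zero]
  exact h1

/-- The restriction of the signature form to `G*`, with reversed sign. -/
noncomputable def diagBlock : InvDual Λ z.G →ₗ[Λ] InvDual Λ (InvDual Λ z.G) :=
  -(dualMap e.gammaT ∘ₗ e.muT + QGroup.pull (adj t.aHom ∘ₗ e.gammaT) ν)

/-- The pairing of `G*` with `F` in the signature form, with reversed sign. -/
noncomputable def offBlock : InvDual Λ z.G →ₗ[Λ] InvDual Λ z.F :=
  ε • (e.muT - adj t.aHom ∘ₗ e.gammaT)

/-- In the variables b = x + ε `toDual` v and Y = y + (`toG` v - β⁻¹ `toG` v) the expression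
separates: x enters only through b and y only through Y. The first flip condition turns the ν-terms
into this shape. -/
theorem total_snd_snd_apply (hν : QGroup.mk (-ε) ν = t.nu) (x : InvDual Λ z.G) (y : z.G) (w : z.F)
    (v : InvDual Λ z.F) (x' : InvDual Λ z.G) (w' : z.F) :
    (t.total e ν ((x, y, w), v)).2.2 (x', w') =
      t.diagBlock e ν (x + ε • e.toDual v) x' +
        ε • v (e.gammaT x') + t.a (z.gamma (y + (e.toG v - t.toG e v))) (e.gammaT x') +
        t.offBlock e (x + ε • e.toDual v) w' + z.mu (y + (e.toG v - t.toG e v)) w' - v w' := by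
  have h1 : (t.total e ν ((x, y, w), v)).2.2 (x', w') =
    (t.embed e ν (x, y, w)).2.2 (x', w') + (t.compl e ν v).2.2 (x', w') := rfl
  have hD : ∀ b, t.diagBlock e ν b x' =
    -(e.muT b (e.gammaT x') + ν (adj t.aHom (e.gammaT b)) (adj t.aHom (e.gammaT x'))) :=
      fun _ => rfl
  have hE : ∀ b, t.offBlock e b w' = ε • (e.muT b w' - star (t.a w' (e.gammaT b))) :=
    fun _ => rfl
  have h2 : ∀ u : z.F, star (t.a u (z.gamma (e.toG v))) = z.mu (t.toG e v) u := by
    intro u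
    rw [← t.adj_gamma_toG e v]
    rfl
  have h3 := t.a_gamma (t.toG e v) (e.gammaT x')
  rw [t.b_toG, ← hν, QGroup.symm_mk_apply] at h3
  rw [h1, embed_snd_snd_apply, compl_snd_snd_apply, hD, hE]
  rcases Int.units_eq_one_or ε with rfl | rfl <;>
    simp [e.gammaT_toDual, e.muT_toDual, t.adj_gamma_toG, h2, h3] <;> abel

/-! ### Split injectivity after γ and after μ -/

/-- Recovering `((x, y, w), v)` from `b = x + ε toDual v`, `Y = y + (toG v - β⁻¹ toG v)`,
`c = w - γ (toG v)` and `v`. -/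
noncomputable def unshear :
    (InvDual Λ z.G × z.G × z.F) × InvDual Λ z.F →ₗ[Λ] z.SigModule × InvDual Λ z.F :=
  LinearMap.id - LinearMap.inl Λ _ _ ∘ₗ
    ((ε • e.toDual).prod ((e.toG - t.toG e).prod (-(z.gamma ∘ₗ e.toG)))) ∘ₗ LinearMap.snd Λ _ _

theorem unshear_apply (x : InvDual Λ z.G) (y : z.G) (w : z.F) (v : InvDual Λ z.F) :
    t.unshear e ((x + ε • e.toDual v, y + (e.toG v - t.toG e v), w + -z.gamma (e.toG v)), v) =
      ((x, y, w), v) := by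
  refine Prod.ext (Prod.ext ?_ (Prod.ext ?_ ?_)) ?_
  · exact add_sub_cancel_right _ _
  · exact add_sub_cancel_right _ _
  · exact add_sub_cancel_right _ _
  · exact sub_zero _

/-- The difference of the `P*`-component and the contribution of the signature form. -/
noncomputable def resid : (InvDual Λ z.G × z.F) × InvDual Λ (InvDual Λ z.G × z.F) →ₗ[Λ]
    InvDual Λ (InvDual Λ z.G) × InvDual Λ z.F :=
  (dualProd Λ (InvDual Λ z.G) z.F).toLinearMap ∘ₗ LinearMap.snd Λ _ _ -
    (t.diagBlock e ν).prod (t.offBlock e) ∘ₗ LinearMap.fst Λ _ _ ∘ₗ LinearMap.fst Λ _ _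

/-- The variable b is itself a coordinate of the image, so its contribution can be subtracted; only
Y and v are left. -/
theorem resid_total (hν : QGroup.mk (-ε) ν = t.nu) (x : InvDual Λ z.G) (y : z.G) (w : z.F)
    (v : InvDual Λ z.F) : t.resid e ν (t.total e ν ((x, y, w), v)).2 =
      (dualMap e.gammaT (ε • v + t.a (z.gamma (y + (e.toG v - t.toG e v)))),
        z.mu (y + (e.toG v - t.toG e v)) - v) := by
  refine Prod.ext (InvDual.ext fun x' => ?_) (InvDual.ext fun w' => ?_)
  · change (t.total e ν ((x, y, w), v)).2.2 (x', 0) - t.diagBlock e ν (x + ε • e.toDual v) x' =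
      ε • v (e.gammaT x') + t.a (z.gamma (y + (e.toG v - t.toG e v))) (e.gammaT x')
    rw [t.total_snd_snd_apply e ν hν]
    simp only [map_zero]
    abel
  · change (t.total e ν ((x, y, w), v)).2.2 (0, w') - t.offBlock e (x + ε • e.toDual v) w' =
      z.mu (y + (e.toG v - t.toG e v)) w' - v w'
    rw [t.total_snd_snd_apply e ν hν]
    simp only [map_zero, smul_zero]
    abel

/-- `G` is recovered from its image under `(γ, μ)`. -/
theorem _root_.SurgeryL.Preformation.Extension.ev_eq (Y : z.G) :
    evEquiv Λ z.G Y = ε • dualMap e.gammaT (z.mu Y) + adj e.muT (z.gamma Y) :=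
  InvDual.ext fun x => e.star_apply x Y

/-- From γ Y and the residues γt*(ε v + α γ Y) and μ Y - v one eliminates v and obtains ε γt*μ Y.
Adding μt*γ Y recovers Y by `ev_eq`. Then v follows from the second residue, and the change of
variables is undone. -/
theorem exists_leftInverse_gamma (hν : QGroup.mk (-ε) ν = t.nu) :
    ∃ R : z.F × ((InvDual Λ z.G × z.F) × InvDual Λ (InvDual Λ z.G × z.F)) →ₗ[Λ]
      z.SigModule × InvDual Λ z.F,
      ∀ q, R (z.gamma (t.total e ν q).1, (t.total e ν q).2) = q := by
  let A := z.F × ((InvDual Λ z.G × z.F) × InvDual Λ (InvDual Λ z.G × z.F))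
  let pF : A →ₗ[Λ] z.F := LinearMap.fst Λ _ _
  let d : A →ₗ[Λ] InvDual Λ (InvDual Λ z.G) :=
    LinearMap.fst Λ _ _ ∘ₗ t.resid e ν ∘ₗ LinearMap.snd Λ _ _
  let c : A →ₗ[Λ] InvDual Λ z.F :=
    LinearMap.snd Λ _ _ ∘ₗ t.resid e ν ∘ₗ LinearMap.snd Λ _ _
  let Y : A →ₗ[Λ] z.G := (evEquiv Λ z.G).symm.toLinearMap ∘ₗ
    (d - dualMap e.gammaT ∘ₗ t.aHom ∘ₗ pF + ε • (dualMap e.gammaT ∘ₗ c) + adj e.muT ∘ₗ pF)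
  let b : A →ₗ[Λ] InvDual Λ z.G × z.F := LinearMap.fst Λ _ _ ∘ₗ LinearMap.snd Λ _ _
  refine ⟨t.unshear e ∘ₗ (((LinearMap.fst Λ _ _ ∘ₗ b).prod
    (Y.prod (LinearMap.snd Λ _ _ ∘ₗ b))).prod (z.mu ∘ₗ Y - c)), ?_⟩
  rintro ⟨⟨x, y, w⟩, v⟩
  have hr := t.resid_total e ν hν x y w v
  set Y₀ := y + (e.toG v - t.toG e v) with hY₀
  set a : A := (z.gamma (t.total e ν ((x, y, w), v)).1, (t.total e ν ((x, y, w), v)).2) with ha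
  have hd : d a = dualMap e.gammaT (ε • v + t.a (z.gamma Y₀)) := congrArg Prod.fst hr
  have hc : c a = z.mu Y₀ - v := congrArg Prod.snd hr
  have hp : pF a = z.gamma Y₀ := rfl
  have hY : Y a = Y₀ := by
    change (evEquiv Λ z.G).symm (d a - dualMap e.gammaT (t.a (pF a)) +
      ε • dualMap e.gammaT (c a) + adj e.muT (pF a)) = Y₀
    rw [LinearEquiv.symm_apply_eq, e.ev_eq, hd, hc, hp]
    rcases Int.units_eq_one_or ε with rfl | rfl <;> simp
    abel
  change t.unshear e ((x + ε • e.toDual v, Y a, w + -z.gamma (e.toG v)), z.mu (Y a) - c a) = _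
  rw [hY, hc, sub_sub_cancel]
  exact t.unshear_apply e x y w v

/-- Now μ Y is known, so the second residue gives v at once. The flip conditions rewrite α γ Y
through μ Y and μ β Y, and give γ β Y as the inverse adjoint of α applied to μ Y. Hence `ev_eq`
recovers β Y and so Y. -/
theorem exists_leftInverse_mu (hν : QGroup.mk (-ε) ν = t.nu) :
    ∃ R : InvDual Λ z.F × ((InvDual Λ z.G × z.F) × InvDual Λ (InvDual Λ z.G × z.F)) →ₗ[Λ]
      z.SigModule × InvDual Λ z.F,
      ∀ q, R (z.mu (t.total e ν q).1, (t.total e ν q).2) = q := by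
  let A := InvDual Λ z.F × ((InvDual Λ z.G × z.F) × InvDual Λ (InvDual Λ z.G × z.F))
  let pF : A →ₗ[Λ] InvDual Λ z.F := LinearMap.fst Λ _ _
  let d : A →ₗ[Λ] InvDual Λ (InvDual Λ z.G) :=
    LinearMap.fst Λ _ _ ∘ₗ t.resid e ν ∘ₗ LinearMap.snd Λ _ _
  let c : A →ₗ[Λ] InvDual Λ z.F :=
    LinearMap.snd Λ _ _ ∘ₗ t.resid e ν ∘ₗ LinearMap.snd Λ _ _
  let v' : A →ₗ[Λ] InvDual Λ z.F := pF - c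
  let Y : A →ₗ[Λ] z.G := t.b.symm.toLinearMap ∘ₗ (evEquiv Λ z.G).symm.toLinearMap ∘ₗ
    (d - ε • (dualMap e.gammaT ∘ₗ v') -
      dualMap e.gammaT ∘ₗ (ε • (dualMap (adj t.aHom) ∘ₗ QGroup.symm t.nu)) ∘ₗ pF +
      adj e.muT ∘ₗ t.adjInv ∘ₗ pF)
  let b : A →ₗ[Λ] InvDual Λ z.G × z.F := LinearMap.fst Λ _ _ ∘ₗ LinearMap.snd Λ _ _
  refine ⟨t.unshear e ∘ₗ (((LinearMap.fst Λ _ _ ∘ₗ b).prod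
    (Y.prod (LinearMap.snd Λ _ _ ∘ₗ b))).prod v'), ?_⟩
  rintro ⟨⟨x, y, w⟩, v⟩
  have hr := t.resid_total e ν hν x y w v
  set Y₀ := y + (e.toG v - t.toG e v) with hY₀
  set a : A := (z.mu (t.total e ν ((x, y, w), v)).1, (t.total e ν ((x, y, w), v)).2) with ha
  have hd : d a = dualMap e.gammaT (ε • v + t.a (z.gamma Y₀)) := congrArg Prod.fst hr
  have hc : c a = z.mu Y₀ - v := congrArg Prod.snd hr
  have hp : pF a = z.mu Y₀ := rfl
  have hv : v' a = v := by
    change pF a - c a = v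
    rw [hp, hc, sub_sub_cancel]
  have hY : Y a = Y₀ := by
    change t.b.symm ((evEquiv Λ z.G).symm (d a - ε • dualMap e.gammaT (v' a) -
      dualMap e.gammaT (ε • dualMap (adj t.aHom) (QGroup.symm t.nu (pF a))) +
      adj e.muT (t.adjInv (pF a)))) = Y₀
    rw [LinearEquiv.symm_apply_eq, LinearEquiv.symm_apply_eq, e.ev_eq, hd, hv, hp, t.gamma_eq,
      ← t.mu_eq Y₀, t.adjInv_adj]
    rcases Int.units_eq_one_or ε with rfl | rfl <;> simp
  change t.unshear e ((x + ε • e.toDual v, Y a, w + -z.gamma (e.toG v)), v' a) = _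
  rw [hY, hv]
  exact t.unshear_apply e x y w v

end FlipIso

end

/-- The underlying modules of the embedded signature form and its complement fill out half of
`F ⊕ H(G* ⊕ F)`. -/
noncomputable def sigEquiv (z : Preformation Λ ε) :
    (z.SigModule × (InvDual Λ z.F × InvDual Λ (InvDual Λ z.F))) ≃ₗ[Λ]
      z.F × ((InvDual Λ z.G × z.F) × InvDual Λ (InvDual Λ z.G × z.F)) :=
  let E : (z.SigModule × (InvDual Λ z.F × z.F)) ≃ₗ[Λ]
      z.F × ((InvDual Λ z.G × z.F) × (z.G × InvDual Λ z.F)) :=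
    { toFun := fun x => (x.1.2.2, ((x.1.1, x.2.2), (x.1.2.1, x.2.1)))
      invFun := fun x => ((x.2.1.1, x.2.2.1, x.1), (x.2.2.2, x.2.1.2))
      map_add' := fun _ _ => rfl
      map_smul' := fun _ _ => rfl
      left_inv := fun _ => rfl
      right_inv := fun _ => rfl }
  ((LinearEquiv.prodCongr (LinearEquiv.refl Λ _)
    (LinearEquiv.prodCongr (LinearEquiv.refl Λ _) (evEquiv Λ z.F).symm)).trans E).trans
    (LinearEquiv.prodCongr (LinearEquiv.refl Λ _) (LinearEquiv.prodCongr (LinearEquiv.refl Λ _)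
      ((LinearEquiv.prodCongr (evEquiv Λ z.G) (LinearEquiv.refl Λ _)).trans
        (dualProd Λ (InvDual Λ z.G) z.F).symm)))

/-- Two stabilizations are needed: ∂H(G* ⊕ F) receives the signature form, and ∂H(A) receives the
hyperbolic summand that makes this form acquire a lagrangian. -/
theorem classIsElementary_of_signature_zero [IsStablyFiniteRing Λ] {z z' : Preformation Λ ε}
    (h : StablyStronglyIso z z') (t : z.FlipIso) (e : z.Extension)
    (ν : InvDual Λ z.F →ₗ[Λ] InvDual Λ (InvDual Λ z.F)) (hν : QGroup.mk (-ε) ν = t.nu)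
    (h0 : z.quadraticSignature t e ν hν = 0) : z'.ClassIsElementary := by
  let P : FreeMod Λ := ⟨InvDual Λ z.G × z.F⟩
  let V : FreeMod Λ := ⟨InvDual Λ z.F⟩
  let S : (P.carrier × InvDual Λ P.carrier) ≃ₗ[Λ]
      InvDual Λ (P.carrier × InvDual Λ P.carrier) :=
    LinearEquiv.ofBijective _ (QGroup.hyp_bijective (ε := -ε))
  obtain ⟨R, hR⟩ := t.exists_leftInverse_gamma e ν hν
  obtain ⟨R', hR'⟩ := t.exists_leftInverse_mu e ν hν
  obtain ⟨A, hA⟩ := exists_isElementary_sum_of_embedding (z.sum (boundaryHyp ε P))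
    ⟨z.SigModule, QGroup.mk (-ε) (sigMap z t e ν), sigMap_bijective z t e ν hν⟩
    (Quotient.exact h0) V (t.total e ν) (t.map_total e ν hν) R hR
    -- On ∂H(P) the map μ is the isomorphism S given by the non-singular hyperbolic form, whereas
    -- `R'` expects the identity there.
    (R' ∘ₗ (LinearMap.id.prodMap S.symm.toLinearMap) ∘ₗ
      (dualProd Λ z.F (P.carrier × InvDual Λ P.carrier)).toLinearMap) (fun q => by
      have hq : dualProd Λ z.F (P.carrier × InvDual Λ P.carrier)
          ((z.sum (boundaryHyp ε P)).mu (t.total e ν q)) =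
          (z.mu (t.total e ν q).1, S (t.total e ν q).2) := by
        refine Prod.ext (InvDual.ext fun f => ?_) (InvDual.ext fun f => ?_)
        · change z.mu (t.total e ν q).1 f + S (t.total e ν q).2 0 = z.mu (t.total e ν q).1 f
          simp
        · change z.mu (t.total e ν q).1 0 + S (t.total e ν q).2 f = S (t.total e ν q).2 f
          simp
      refine (congrArg (fun y => R' (y.1, S.symm y.2)) hq).trans ?_
      simp only [LinearEquiv.symm_apply_apply]
      exact hR' q) z.sigEquiv
  exact ⟨_, (h.sum_boundaryHyp P).sum_boundaryHyp A, hA⟩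

end Preformation
end SurgeryL

theorem mainTheorem8 {Λ : Type u} [Ring Λ] [StarRing Λ] [IsStablyFiniteRing Λ] (q : ℕ)
    (z' : SurgeryL.Preformation Λ ((-1) ^ q)) (hz' : z'.IsNonsingularFormation) :
    z'.ClassIsElementary ↔
      ∃ z : SurgeryL.Preformation Λ ((-1) ^ q), SurgeryL.Preformation.StablyStronglyIso z z' ∧
        ∃ (t : z.FlipIso) (e : z.Extension)
          (ν : SurgeryL.InvDual Λ z.F →ₗ[Λ] SurgeryL.InvDual Λ (SurgeryL.InvDual Λ z.F))
          (hν : SurgeryL.QGroup.mk (-(-1) ^ q) ν = t.nu),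
          z.quadraticSignature t e ν hν = 0 := by
  refine ⟨SurgeryL.Preformation.exists_signature_zero_of_classIsElementary hz', ?_⟩
  rintro ⟨z, h, t, e, ν, hν, h0⟩
  exact SurgeryL.Preformation.classIsElementary_of_signature_zero h t e ν hν h0
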